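/- An instance of Closest String consists of $k\ge 1$ strings $s_1,\dots,s_k$, each of length $L\ge 1$, over a finite alphabet $\Sigma=\{0,\dots,\sigma-1\}$ whose size $\sigma$ is part of the input, and an integer $d\ge 0$. The task is to find a string $y\in\Sigma^L$ whose Hamming distance to each $s_i$ is at most $d$, or to report that no such string exists. Binary Closest String is the restriction to instances with $\Sigma=\{0,1\}$. Time is the number of steps of a random access machine that is given $k$, $L$, $d$, $\sigma$ and each letter of the strings in one cell each, and that performs additions, truncated subtractions, copies, direct and indirect reads and writes, and tests for zero, in one step each. Then Closest String can be solved in time $k^{O(k^2)}\cdot L^{O(1)}$, and Binary Closest String can be solved in time $2^{O(k^2)}\cdot L^{O(1)}$. That is, there are a single program $P$ and a constant $C$ such that $P$ solves every instance of Closest String in at most $C\cdot k^{Ck^2}\cdot L^C$ steps, where $C$ depends on none of $k,L,d,\sigma$ and the instance; and there are a program $P'$ and a constant $C'$ such that $P'$ solves every instance of Binary Closest String in at most $C'\cdot 2^{C'k^2}\cdot L^{C'}$ steps. -/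

import Mathlib

/-! ## Random access machine programs with unit-cost step counting -/

namespace RAM

/-- A machine state: registers (addressed by constants of the program) and a main memory
(addressed indirectly, through the content of a register). All cells hold natural numbers. -/
structure State where
  reg : ℕ → ℕ
  mem : ℕ → ℕ

/-- Assign the value `v` to register `x`. -/
def State.setReg (s : State) (x v : ℕ) : State := ⟨Function.update s.reg x v, s.mem⟩

/-- Write the value `v` into the memory cell with address `a`. -/
def State.setMem (s : State) (a v : ℕ) : State := ⟨s.reg, Function.update s.mem a v⟩

/-- Programs of a random access machine. The arithmetic is restricted to addition and truncated
subtraction (no multiplication and no bit operations), so that counting every instruction and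
every test as one step is polynomially equivalent to Turing machine time. -/
inductive Program : Type
  /-- do nothing -/
  | skip : Program
  /-- `R[x] := n` -/
  | const (x n : ℕ) : Program
  /-- `R[x] := R[y]` -/
  | copy (x y : ℕ) : Program
  /-- `R[x] := R[y] + R[z]` -/
  | add (x y z : ℕ) : Program
  /-- `R[x] := max (R[y] - R[z]) 0` -/
  | sub (x y z : ℕ) : Program
  /-- `R[x] := M[R[y]]` -/
  | load (x y : ℕ) : Program
  /-- `M[R[x]] := R[y]` -/
  | store (x y : ℕ) : Program
  /-- first `p`, then `q` -/
  | seq (p q : Program) : Program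
  /-- if `R[x] > 0` then `p` else `q` -/
  | ifPos (x : ℕ) (p q : Program) : Program
  /-- while `R[x] > 0` do `p` -/
  | whilePos (x : ℕ) (p : Program) : Program

/-- `Runs p s t s'`: started in state `s`, the program `p` halts in state `s'` after exactly `t`
steps. Every execution of an elementary instruction and every evaluation of a test is one step. -/
inductive Runs : Program → State → ℕ → State → Prop
  | skip (s : State) : Runs .skip s 1 s
  | const (s : State) (x n : ℕ) : Runs (.const x n) s 1 (s.setReg x n)
  | copy (s : State) (x y : ℕ) : Runs (.copy x y) s 1 (s.setReg x (s.reg y))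
  | add (s : State) (x y z : ℕ) : Runs (.add x y z) s 1 (s.setReg x (s.reg y + s.reg z))
  | sub (s : State) (x y z : ℕ) : Runs (.sub x y z) s 1 (s.setReg x (s.reg y - s.reg z))
  | load (s : State) (x y : ℕ) : Runs (.load x y) s 1 (s.setReg x (s.mem (s.reg y)))
  | store (s : State) (x y : ℕ) : Runs (.store x y) s 1 (s.setMem (s.reg x) (s.reg y))
  | seq {p q : Program} {s s' s'' : State} {t t' : ℕ} :
      Runs p s t s' → Runs q s' t' s'' → Runs (.seq p q) s (t + t') s''
  | ifTrue {x : ℕ} {p q : Program} {s s' : State} {t : ℕ} :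
      0 < s.reg x → Runs p s t s' → Runs (.ifPos x p q) s (t + 1) s'
  | ifFalse {x : ℕ} {p q : Program} {s s' : State} {t : ℕ} :
      s.reg x = 0 → Runs q s t s' → Runs (.ifPos x p q) s (t + 1) s'
  | whileTrue {x : ℕ} {p : Program} {s s' s'' : State} {t t' : ℕ} :
      0 < s.reg x → Runs p s t s' → Runs (.whilePos x p) s' t' s'' →
        Runs (.whilePos x p) s (t + t' + 1) s''
  | whileFalse {x : ℕ} {p : Program} {s : State} :
      s.reg x = 0 → Runs (.whilePos x p) s 1 s

end RAM

/-! ## The problem Closest String -/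

/-- An instance of Closest String: `k ≥ 1` strings of the same length `L ≥ 1` over the alphabet
`{0, …, σ - 1}`, whose size `σ` is part of the instance, and a distance bound `d`. -/
structure ClosestString where
  k : ℕ
  L : ℕ
  d : ℕ
  σ : ℕ
  k_pos : 0 < k
  L_pos : 0 < L
  str : Fin k → Fin L → Fin σ

namespace ClosestString

/-- Binary Closest String: the alphabet is `{0, 1}`. -/
def IsBinary (I : ClosestString) : Prop := I.σ = 2

/-- A string over the alphabet is a solution if its Hamming distance to every input string is at
most `d`. -/
def IsSolution (I : ClosestString) (y : Fin I.L → Fin I.σ) : Prop :=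
  ∀ i, hammingDist y (I.str i) ≤ I.d

/-- The input convention: registers `0, 1, 2, 3` hold `k, L, d, σ`, the memory cell `i * L + j`
holds the `j`-th letter of the `i`-th string (both counted from `0`), everything else is `0`. -/
def input (I : ClosestString) : RAM.State where
  reg x := match x with
    | 0 => I.k
    | 1 => I.L
    | 2 => I.d
    | 3 => I.σ
    | _ => 0
  mem a := if h : a < I.k * I.L then
      (I.str ⟨a / I.L, Nat.div_lt_of_lt_mul (by rwa [Nat.mul_comm] at h)⟩
        ⟨a % I.L, Nat.mod_lt a I.L_pos⟩ : ℕ)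
    else 0

/-- The output convention: either register `0` holds `1` and the first `L` memory cells hold a
solution, or register `0` holds `0` and there is no solution. -/
def IsCorrectOutput (I : ClosestString) (s : RAM.State) : Prop :=
  (s.reg 0 = 1 ∧ ∃ y, I.IsSolution y ∧ ∀ j : Fin I.L, s.mem j = (y j : ℕ)) ∨
    (s.reg 0 = 0 ∧ ¬ ∃ y, I.IsSolution y)

/-- The program `P` solves the instance `I` within `T` steps. -/
def SolvedWithin (I : ClosestString) (P : RAM.Program) (T : ℕ) : Prop :=
  ∃ (t : ℕ) (s : RAM.State), RAM.Runs P I.input t s ∧ t ≤ T ∧ I.IsCorrectOutput s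

end ClosestString

/-! Only the equality pattern of a column, its type, matters. It may be assumed that a solution
takes each letter from some row of its column, so a solution is a choice of rows. Start with every
column as a group of weight 1. If more than `k` groups share type and weight, then any choice of
rows uses the same row on two of them. Groups of equal type and weight are interchangeable, so these
two may be taken to be any prescribed pair, and that pair can be merged into one group of twice the
weight (`Grouping.merge`). When no merge is possible, all weights are powers of two and each pair of
type and weight occurs at most `k` times.

A dynamic program then treats the groups in order of decreasing weight. It remembers, for each row,
the remaining distance budget capped at the total weight still to come. The cap loses nothing, since
no row can lose more than that (`Feasible.slack_insert`). Choices with the same budget vector have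
the same continuations, so one representative string per vector suffices.

The number of vectors is small (`card_le_of_slack`). While weight `2 ^ e` is treated, all loads so
far are multiples of `2 ^ e`, so an uncapped budget has the residue of `d` modulo `2 ^ e`. By a
geometric sum the remaining weight is at most `2 * k * T * 2 ^ e` for `T` types (`rest_le`). Hence
each coordinate takes at most `2 * k * T + 2` values. With `T` at most `k ^ k` in general, or `2 ^
k` in the binary case, raising this to the power `k` gives both bounds, and one program serves for
both.

The rest implements this on the machine, with a total-correctness calculus `wp` that carries step
bounds. -/

namespace RAM

-- A program logic with step bounds

infixr:60 " ;; " => Program.seq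

/-- The registers that a program may write. -/
def Program.writes : Program → List ℕ
  | .skip => []
  | .const x _ => [x]
  | .copy x _ => [x]
  | .add x _ _ => [x]
  | .sub x _ _ => [x]
  | .load x _ => [x]
  | .store _ _ => []
  | .seq p q => p.writes ++ q.writes
  | .ifPos _ p q => p.writes ++ q.writes
  | .whilePos _ p => p.writes

/-- Whether a program contains an instruction that writes to the memory. -/
def Program.stores : Program → Bool
  | .store _ _ => true
  | .seq p q => p.stores || q.stores
  | .ifPos _ p q => p.stores || q.stores
  | .whilePos _ p => p.stores
  | _ => false

/-- What a run of `p` from `s` to `s'` leaves unchanged for syntactic reasons. -/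
structure Frame (p : Program) (s s' : State) : Prop where
  reg : ∀ r, r ∉ p.writes → s'.reg r = s.reg r
  mem : p.stores = false → s'.mem = s.mem

theorem State.setReg_reg_of_ne (s : State) {x r : ℕ} (v : ℕ) (h : r ≠ x) :
    (s.setReg x v).reg r = s.reg r := Function.update_of_ne h _ _

/-- Every rule of the calculus hands this frame to the postcondition, so invariants list only what
changes; that a register survives is then settled by `decide` on the list of written registers. -/
theorem Runs.frame {p : Program} {s s' : State} {t : ℕ} (h : Runs p s t s') : Frame p s s' := by
  induction h with
  | skip s => exact ⟨fun _ _ => rfl, fun _ => rfl⟩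
  | const s x n =>
    exact ⟨fun r hr => s.setReg_reg_of_ne _ (by simpa [Program.writes] using hr), fun _ => rfl⟩
  | copy s x n =>
    exact ⟨fun r hr => s.setReg_reg_of_ne _ (by simpa [Program.writes] using hr), fun _ => rfl⟩
  | add s x y z =>
    exact ⟨fun r hr => s.setReg_reg_of_ne _ (by simpa [Program.writes] using hr), fun _ => rfl⟩
  | sub s x y z =>
    exact ⟨fun r hr => s.setReg_reg_of_ne _ (by simpa [Program.writes] using hr), fun _ => rfl⟩
  | load s x y =>
    exact ⟨fun r hr => s.setReg_reg_of_ne _ (by simpa [Program.writes] using hr), fun _ => rfl⟩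
  | store s x y => exact ⟨fun _ _ => rfl, fun h => by simp [Program.stores] at h⟩
  | seq _ _ ih₁ ih₂ =>
    refine ⟨fun r hr => ?_, fun hm => ?_⟩
    · simp only [Program.writes, List.mem_append, not_or] at hr
      rw [ih₂.reg r hr.2, ih₁.reg r hr.1]
    · simp only [Program.stores, Bool.or_eq_false_iff] at hm
      rw [ih₂.mem hm.2, ih₁.mem hm.1]
  | ifTrue _ _ ih =>
    refine ⟨fun r hr => ?_, fun hm => ?_⟩
    · simp only [Program.writes, List.mem_append, not_or] at hr
      exact ih.reg r hr.1
    · simp only [Program.stores, Bool.or_eq_false_iff] at hm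
      exact ih.mem hm.1
  | ifFalse _ _ ih =>
    refine ⟨fun r hr => ?_, fun hm => ?_⟩
    · simp only [Program.writes, List.mem_append, not_or] at hr
      exact ih.reg r hr.2
    · simp only [Program.stores, Bool.or_eq_false_iff] at hm
      exact ih.mem hm.2
  | whileTrue _ _ _ ih₁ ih₂ =>
    exact ⟨fun r hr => by rw [ih₂.reg r hr, ih₁.reg r hr], fun hm => by rw [ih₂.mem hm, ih₁.mem hm]⟩
  | whileFalse _ => exact ⟨fun _ _ => rfl, fun _ => rfl⟩

/-- Started in `s`, the program `p` halts within `T` steps in a state that satisfies `Q`. -/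
def wp (p : Program) (T : ℕ) (Q : State → Prop) (s : State) : Prop :=
  ∃ t s', Runs p s t s' ∧ t ≤ T ∧ Q s'

theorem wp.mono {p : Program} {T T' : ℕ} {Q Q' : State → Prop} {s : State}
    (h : wp p T Q s) (hT : T ≤ T') (hQ : ∀ s', Frame p s s' → Q s' → Q' s') : wp p T' Q' s := by
  obtain ⟨t, s', hr, ht, hq⟩ := h
  exact ⟨t, s', hr, ht.trans hT, hQ s' hr.frame hq⟩

theorem wp.seq {p q : Program} {T₁ T₂ T : ℕ} {Q₁ Q : State → Prop} {s : State}
    (h₁ : wp p T₁ Q₁ s) (h₂ : ∀ s₁, Frame p s s₁ → Q₁ s₁ → wp q T₂ Q s₁) (hT : T₁ + T₂ ≤ T) :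
    wp (p ;; q) T Q s := by
  obtain ⟨t, s', hr, ht, hq⟩ := h₁
  obtain ⟨t', s'', hr', ht', hq'⟩ := h₂ s' hr.frame hq
  exact ⟨t + t', s'', hr.seq hr', by omega, hq'⟩

theorem wp.ifPos {x : ℕ} {p q : Program} {T T' : ℕ} {Q : State → Prop} {s : State}
    (hp : 0 < s.reg x → wp p T Q s) (hq : s.reg x = 0 → wp q T Q s) (hT : T + 1 ≤ T') :
    wp (.ifPos x p q) T' Q s := by
  rcases Nat.eq_zero_or_pos (s.reg x) with h | h
  · obtain ⟨t, s', hr, ht, hQ⟩ := hq h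
    exact ⟨t + 1, s', .ifFalse h hr, by omega, hQ⟩
  · obtain ⟨t, s', hr, ht, hQ⟩ := hp h
    exact ⟨t + 1, s', .ifTrue h hr, by omega, hQ⟩

/-- The final state of a program without loops. -/
def Program.run : Program → State → State
  | .skip, s => s
  | .const x n, s => s.setReg x n
  | .copy x y, s => s.setReg x (s.reg y)
  | .add x y z, s => s.setReg x (s.reg y + s.reg z)
  | .sub x y z, s => s.setReg x (s.reg y - s.reg z)
  | .load x y, s => s.setReg x (s.mem (s.reg y))
  | .store x y, s => s.setMem (s.reg x) (s.reg y)
  | .seq p q, s => q.run (p.run s)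
  | .ifPos x p q, s => if 0 < s.reg x then p.run s else q.run s
  | .whilePos _ _, s => s

/-- A bound on the number of steps of a program without loops. -/
def Program.cost : Program → ℕ
  | .seq p q => p.cost + q.cost
  | .ifPos _ p q => max p.cost q.cost + 1
  | _ => 1

/-- Whether a program contains no loop. -/
def Program.loopFree : Program → Bool
  | .seq p q => p.loopFree && q.loopFree
  | .ifPos _ p q => p.loopFree && q.loopFree
  | .whilePos _ _ => false
  | _ => true

theorem exists_runs_of_loopFree {p : Program} (hp : p.loopFree = true) (s : State) :
    ∃ t, Runs p s t (p.run s) ∧ t ≤ p.cost := by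
  induction p generalizing s with
  | skip => exact ⟨1, .skip s, le_rfl⟩
  | const x n => exact ⟨1, .const s x n, le_rfl⟩
  | copy x y => exact ⟨1, .copy s x y, le_rfl⟩
  | add x y z => exact ⟨1, .add s x y z, le_rfl⟩
  | sub x y z => exact ⟨1, .sub s x y z, le_rfl⟩
  | load x y => exact ⟨1, .load s x y, le_rfl⟩
  | store x y => exact ⟨1, .store s x y, le_rfl⟩
  | seq p q ihp ihq =>
    simp only [Program.loopFree, Bool.and_eq_true] at hp
    obtain ⟨t, hr, ht⟩ := ihp hp.1 s
    obtain ⟨t', hr', ht'⟩ := ihq hp.2 (p.run s)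
    exact ⟨t + t', hr.seq hr', by simp only [Program.cost]; omega⟩
  | ifPos x p q ihp ihq =>
    simp only [Program.loopFree, Bool.and_eq_true] at hp
    by_cases h : 0 < s.reg x
    · obtain ⟨t, hr, ht⟩ := ihp hp.1 s
      exact ⟨t + 1, by simpa only [Program.run, if_pos h] using .ifTrue h hr,
        by simp only [Program.cost]; omega⟩
    · obtain ⟨t, hr, ht⟩ := ihq hp.2 s
      exact ⟨t + 1, by simpa only [Program.run, if_neg h] using .ifFalse (by omega) hr,
        by simp only [Program.cost]; omega⟩
  | whilePos x p => simp [Program.loopFree] at hp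

/-- Turns straight-line code into symbolic execution: the final state is a term that `simp` can
evaluate. -/
theorem wp_of_loopFree {p : Program} {T : ℕ} {Q : State → Prop} {s : State}
    (hp : p.loopFree = true) (hT : p.cost ≤ T) (hQ : Q (p.run s)) : wp p T Q s := by
  obtain ⟨t, hr, ht⟩ := exists_runs_of_loopFree hp s
  exact ⟨t, _, hr, ht.trans hT, hQ⟩

/-- The index of `Inv` is a variant that drops in each iteration, so it bounds the number of
iterations and proves termination as well. -/
theorem wp_while {x : ℕ} {p : Program} {T : ℕ} (Inv : ℕ → State → Prop)
    (hb : ∀ n s, Inv n s → 0 < s.reg x → wp p T (fun s' => ∃ m < n, Inv m s') s)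
    (n : ℕ) (s : State) (h : Inv n s) :
    wp (.whilePos x p) (n * (T + 1) + 1) (fun s' => (∃ m, Inv m s') ∧ s'.reg x = 0) s := by
  induction n using Nat.strong_induction_on generalizing s with
  | _ n ih =>
    rcases Nat.eq_zero_or_pos (s.reg x) with h0 | h0
    · exact ⟨1, s, .whileFalse h0, by omega, ⟨n, h⟩, h0⟩
    · obtain ⟨t, s', hr, ht, m, hm, hi⟩ := hb n s h h0
      obtain ⟨t', s'', hr', ht', hq⟩ := ih m hm s' hi
      refine ⟨t + t' + 1, s'', .whileTrue h0 hr hr', ?_, hq⟩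
      have : (m + 1) * (T + 1) ≤ n * (T + 1) := Nat.mul_le_mul_right _ hm
      linarith

/-- Run `p` with the values `0, 1, …, R[n] - 1` in register `i`; register `t` is auxiliary. -/
def forLoop (i n t : ℕ) (p : Program) : Program :=
  .const i 0 ;; .sub t n i ;; .whilePos t (p ;; .const t 1 ;; .add i i t ;; .sub t n i)

/-- Hypothesis `hst` makes the invariant insensitive to the two control registers, which the loop
itself overwrites between runs of the body. The extra 4 per iteration is the loop test and three
control instructions. -/
theorem wp_for {i n t T' : ℕ} {p : Program} {s : State} {Q : State → Prop} (N T : ℕ)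
    (Inv : ℕ → State → Prop)
    (hN : s.reg n = N) (hin : i ≠ n ∧ t ≠ n ∧ i ≠ t) (hw : i ∉ p.writes ∧ n ∉ p.writes)
    (hst : ∀ m s v, Inv m s → Inv m (s.setReg i v) ∧ Inv m (s.setReg t v))
    (h0 : Inv 0 s)
    (hb : ∀ m < N, ∀ s', Frame (forLoop i n t p) s s' → s'.reg i = m → Inv m s' →
      wp p T (Inv (m + 1)) s')
    (hQ : ∀ s', Frame (forLoop i n t p) s s' → Inv N s' → Q s') (hT : N * (T + 4) + 3 ≤ T') :
    wp (forLoop i n t p) T' Q s := by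
  suffices H : wp (forLoop i n t p) (N * (T + 4) + 3) (Inv N) s from H.mono hT hQ
  obtain ⟨hin, htn, hit⟩ := hin
  have hframe : ∀ s', (∀ r, r ∉ p.writes → r ≠ i → r ≠ t → s'.reg r = s.reg r) →
      (p.stores = false → s'.mem = s.mem) → Frame (forLoop i n t p) s s' := by
    intro s' h1 h2
    refine ⟨fun r hr => ?_, fun h => h2 ?_⟩
    · simp only [forLoop, Program.writes, List.mem_append, List.mem_singleton, not_or] at hr
      exact h1 r hr.2.2.1 hr.1 hr.2.1
    · simpa [forLoop, Program.stores] using h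
  -- The variant `c` is the number of remaining iterations, which is also the content of the
  -- register `t` that is tested.
  let J : ℕ → State → Prop := fun c s' => (∀ r, r ∉ p.writes → r ≠ i → r ≠ t → s'.reg r = s.reg r) ∧
      (p.stores = false → s'.mem = s.mem) ∧ c = s'.reg t ∧ c ≤ N ∧ s'.reg i = N - c ∧
      s'.reg n = N ∧ Inv (N - c) s'
  refine wp.seq (T₁ := 1) (T₂ := 1 + (N * (T + 3 + 1) + 1))
    (Q₁ := fun s' => s' = s.setReg i 0) (wp_of_loopFree rfl le_rfl rfl) ?_
    (by rw [show T + 3 + 1 = T + 4 from rfl]; omega)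
  rintro s₁ - rfl
  refine wp.seq (T₁ := 1) (T₂ := N * (T + 3 + 1) + 1)
    (Q₁ := fun s' => s' = (s.setReg i 0).setReg t N) (wp_of_loopFree rfl le_rfl ?_) ?_ (by omega)
  · simp [Program.run, State.setReg, Function.update_of_ne hin.symm, hN]
  rintro s₂ - rfl
  refine (wp_while (T := T + 3) J ?_ N _ ?_).mono le_rfl ?_
  · rintro c s' ⟨hr, hm, hc, hcN, hi, hn, hI⟩ hpos
    have hcp : 0 < c := hc ▸ hpos
    refine wp.seq (T₁ := T) (T₂ := 3)
      (hb (N - c) (by omega) s' (hframe s' hr hm) hi hI) ?_ le_rfl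
    intro s₃ hf hI3
    refine wp_of_loopFree rfl le_rfl ⟨c - 1, by omega, ?_⟩
    have e1 : s₃.reg i = N - c := by rw [hf.reg i hw.1, hi]
    have e2 : s₃.reg n = N := by rw [hf.reg n hw.2, hn]
    have hs : (Program.const t 1 ;; Program.add i i t ;; Program.sub t n i).run s₃ =
        ((s₃.setReg t 1).setReg i (N - c + 1)).setReg t (c - 1) := by
      simp only [Program.run, State.setReg]
      simp [Function.update_of_ne hit, Function.update_of_ne hin.symm,
        Function.update_of_ne htn.symm, e1, e2]
      congr 1
      omega
    rw [hs]
    refine ⟨fun r h1 h2 h3 => ?_, fun hp => ?_, ?_, by omega, ?_, ?_, ?_⟩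
    · simp [State.setReg, Function.update_of_ne h2, Function.update_of_ne h3, hf.reg r h1,
        hr r h1 h2 h3]
    · simp [State.setReg, hf.mem hp, hm hp]
    · simp [State.setReg]
    · simp [State.setReg, Function.update_of_ne hit]; omega
    · simp [State.setReg, Function.update_of_ne hin.symm, Function.update_of_ne htn.symm, e2]
    · have : N - (c - 1) = N - c + 1 := by omega
      rw [this]
      exact (hst _ _ _ (hst _ _ _ (hst _ _ _ hI3).2).1).2
  · refine ⟨fun r h1 h2 h3 => ?_, fun _ => rfl, ?_, le_rfl, ?_, ?_, ?_⟩
    · simp [State.setReg, Function.update_of_ne h2, Function.update_of_ne h3]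
    · simp [State.setReg]
    · simp [State.setReg, Function.update_of_ne hit]
    · simp [State.setReg, Function.update_of_ne hin.symm, Function.update_of_ne htn.symm, hN]
    · rw [Nat.sub_self]
      exact (hst _ _ _ (hst _ _ _ h0).1).2
  · rintro s' - ⟨⟨c, -, -, hc, -, -, -, hI⟩, ht⟩
    have : c = 0 := by rw [hc, ht]
    subst this
    exact hI

end RAM

/-! ### Column types and the merging of groups -/

namespace ClosestString

open Finset RAM

/-- `1` if rows `c` and `i` of the array `a` differ in column `j`, and `0` otherwise. -/
def mis (a : ℕ → ℕ → ℕ) (c i j : ℕ) : ℕ := if a c j = a i j then 0 else 1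

/-- The columns `x` and `y` (with `k` entries each) have the same equality pattern. -/
def SameType (k : ℕ) (a : ℕ → ℕ → ℕ) (x y : ℕ) : Prop :=
  ∀ p < k, ∀ q < k, (a p x = a q x ↔ a p y = a q y)

theorem SameType.refl (k : ℕ) (a : ℕ → ℕ → ℕ) (x : ℕ) : SameType k a x x :=
  fun _ _ _ _ => Iff.rfl

theorem SameType.symm {k : ℕ} {a : ℕ → ℕ → ℕ} {x y : ℕ} (h : SameType k a x y) :
    SameType k a y x := fun p hp q hq => (h p hp q hq).symm

theorem SameType.trans {k : ℕ} {a : ℕ → ℕ → ℕ} {x y z : ℕ} (h : SameType k a x y)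
    (h' : SameType k a y z) : SameType k a x z :=
  fun p hp q hq => (h p hp q hq).trans (h' p hp q hq)

theorem SameType.mis_eq {k : ℕ} {a : ℕ → ℕ → ℕ} {x y : ℕ} (h : SameType k a x y) {c i : ℕ}
    (hc : c < k) (hi : i < k) : mis a c i x = mis a c i y := by
  simp only [mis, h c hc i hi]

/-- The mismatches with row `i` on the groups in `D`, when row `c j` is chosen for group `j` of
weight `w j`. -/
def load (a : ℕ → ℕ → ℕ) (w c : ℕ → ℕ) (i : ℕ) (D : Finset ℕ) : ℕ := ∑ j ∈ D, w j * mis a (c j) i j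

/-- The columns are partitioned into groups of columns of equal type (`g x` names the group of
the column `x`), the sizes `w` are powers of two, and if there is a solution at all then there is
one that makes a uniform choice of a row on every group. -/
structure Grouping (k L d : ℕ) (a : ℕ → ℕ → ℕ) (w g : ℕ → ℕ) : Prop where
  g_lt : ∀ x < L, g x < L
  type : ∀ x < L, SameType k a x (g x)
  w_eq : ∀ j < L, w j = #{x ∈ range L | g x = j}
  pow : ∀ j < L, w j ≠ 0 → ∃ e, w j = 2 ^ e
  complete : ∀ y : ℕ → ℕ, (∀ i < k, #{x ∈ range L | y x ≠ a i x} ≤ d) →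
    ∃ c : ℕ → ℕ, (∀ j, c j < k) ∧ ∀ i < k, load a w c i (range L) ≤ d

/-- A letter of `y` that occurs in its column is taken from a row that has it. Any other letter
mismatches all rows of the column, so replacing it by the letter of row 0 costs nothing. -/
theorem Grouping.init {k L d : ℕ} {a : ℕ → ℕ → ℕ} {w g : ℕ → ℕ} (hk : 0 < k)
    (hw : ∀ x < L, w x = 1) (hg : ∀ x < L, g x = x) : Grouping k L d a w g where
  g_lt x hx := by rwa [hg x hx]
  type x hx := by rw [hg x hx]; exact .refl k a x
  w_eq j hj := by
    rw [hw j hj, eq_comm, card_eq_one]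
    refine ⟨j, ?_⟩
    ext x
    simp only [mem_filter, mem_range, mem_singleton]
    constructor
    · rintro ⟨h1, h2⟩; rw [← h2, hg x h1]
    · rintro rfl; exact ⟨hj, hg x hj⟩
  pow j hj _ := ⟨0, hw j hj⟩
  complete y hy := by
    classical
    have : ∀ j, ∃ c < k, ∀ i < k, mis a c i j ≤ if y j ≠ a i j then 1 else 0 := by
      intro j
      by_cases h : ∃ c < k, a c j = y j
      · obtain ⟨c, hc, he⟩ := h
        exact ⟨c, hc, fun i _ => by unfold mis; rw [he]; split_ifs <;> simp_all⟩
      · push Not at h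
        refine ⟨0, hk, fun i hi => ?_⟩
        rw [if_pos (h i hi).symm]
        unfold mis; split_ifs <;> simp
    choose c hc h using this
    refine ⟨c, hc, fun i hi => le_trans ?_ (hy i hi)⟩
    rw [card_filter]
    refine sum_le_sum fun j hj => ?_
    rw [hw j (mem_range.1 hj), one_mul]
    exact h j i hi

/-- More than `k` groups of the same type and size: two of them can be merged. -/
theorem Grouping.merge {k L d : ℕ} {a : ℕ → ℕ → ℕ} {w g : ℕ → ℕ} (h : Grouping k L d a w g)
    {j l : ℕ} (hj : j < L) (hl : l < j) (ht : SameType k a l j) (hwl : w l = w j) (hw0 : w j ≠ 0)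
    (I : Finset ℕ) (hI : k ≤ #I)
    (hIm : ∀ i ∈ I, i < j ∧ w i = w j ∧ SameType k a i j) :
    Grouping k L d a (Function.update (Function.update w j (w j + w j)) l 0)
      (fun x => if g x = l then j else g x) where
  g_lt x hx := by
    split_ifs
    · exact hj
    · exact h.g_lt x hx
  type x hx := by
    split_ifs with h1
    · exact (h1 ▸ h.type x hx).trans ht
    · exact h.type x hx
  w_eq i hi := by
    have hlL : l < L := hl.trans hj
    rcases eq_or_ne i l with rfl | hil
    · rw [Function.update_self, eq_comm, card_eq_zero, filter_eq_empty_iff]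
      intro x _
      split_ifs <;> omega
    rw [Function.update_of_ne hil]
    rcases eq_or_ne i j with rfl | hij
    · rw [Function.update_self]
      nth_rewrite 1 [← hwl]
      rw [h.w_eq l hlL, h.w_eq i hj, ← card_union_of_disjoint]
      · congr 1
        ext x
        simp only [mem_union, mem_filter, mem_range]
        split_ifs <;> simp_all
      · rw [disjoint_filter]
        intro x _ h1 h2
        omega
    · rw [Function.update_of_ne hij, h.w_eq i hi]
      congr 1
      ext x
      simp only [mem_filter, mem_range]
      split_ifs with h1
      · exact ⟨fun h2 => absurd (h1 ▸ h2.2).symm hil, fun h2 => absurd h2.2.symm hij⟩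
      · rfl
  pow i hi hne := by
    rcases eq_or_ne i l with rfl | hil
    · simp at hne
    rw [Function.update_of_ne hil] at hne ⊢
    rcases eq_or_ne i j with rfl | hij
    · rw [Function.update_self]
      obtain ⟨e, he⟩ := h.pow i hi hw0
      exact ⟨e + 1, by rw [he, pow_succ]; ring⟩
    · rw [Function.update_of_ne hij] at hne ⊢
      exact h.pow i hi hne
  complete y hy := by
    obtain ⟨c, hc, hcd⟩ := h.complete y hy
    have hjI : j ∉ I := fun hjI => (hIm j hjI).1.false
    -- Pigeonhole: `j` and the groups in `I` are at least `k + 1` groups, but there are only `k`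
    -- rows.
    obtain ⟨p, hp, q, hq, hpq, hcpq⟩ : ∃ p ∈ insert j I, ∃ q ∈ insert j I, p ≠ q ∧ c p = c q := by
      refine exists_ne_map_eq_of_card_lt_of_maps_to (t := range k) ?_
        (fun x _ => mem_coe.2 (mem_range.2 (hc x)))
      rw [card_insert_of_notMem hjI, card_range]
      omega
    have hcl : ∀ x ∈ insert j I, x < L ∧ w x = w j ∧ SameType k a x j := by
      intro x hx
      rcases mem_insert.1 hx with rfl | hx
      · exact ⟨hj, rfl, .refl k a x⟩
      · exact ⟨(hIm x hx).1.trans hj, (hIm x hx).2⟩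
    -- The pair `p`, `q` depends on the unknown choice `c`, while the merged pair `j`, `l` is fixed.
    -- A permutation inside the class of equal type and weight moves one pair to the other, so `c ∘
    -- σ` has the loads of `c` and agrees on `j` and `l`.
    obtain ⟨σ, hσj, hσl, hσ⟩ : ∃ σ : Equiv.Perm ℕ, σ j = p ∧ σ l = q ∧
        ∀ x, σ x ≠ x → x < L ∧ w x = w j ∧ SameType k a x j := by
      set s := Equiv.swap j p with hs
      have hsj : s j = p := Equiv.swap_apply_left j p
      have hcj : ∀ x, (x = j ∨ x = p ∨ x = q ∨ x = l) →
          x < L ∧ w x = w j ∧ SameType k a x j := by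
        rintro x (rfl | rfl | rfl | rfl)
        · exact ⟨hj, rfl, .refl k a x⟩
        · exact hcl x hp
        · exact hcl x hq
        · exact ⟨hl.trans hj, hwl, ht⟩
      have hsl : s l = l ∨ s l = j := by
        rcases eq_or_ne l p with rfl | h1
        · right; exact Equiv.swap_apply_right j l
        · left; exact Equiv.swap_apply_of_ne_of_ne hl.ne h1
      have hpl : p ≠ s l := by
        rw [← hsj]; exact fun h => hl.ne' (s.injective h)
      refine ⟨s.trans (Equiv.swap (s l) q), ?_, ?_, fun x hx => ?_⟩
      · rw [Equiv.trans_apply, hsj]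
        exact Equiv.swap_apply_of_ne_of_ne hpl hpq
      · exact Equiv.swap_apply_left _ _
      · apply hcj
        by_contra hcon
        push Not at hcon
        obtain ⟨h1, h2, h3, h4⟩ := hcon
        apply hx
        rw [Equiv.trans_apply, show s x = x from Equiv.swap_apply_of_ne_of_ne h1 h2]
        refine Equiv.swap_apply_of_ne_of_ne ?_ h3
        rcases hsl with h | h <;> rw [h] <;> assumption
    have hσc : ∀ x, (σ x < L ↔ x < L) ∧ (x < L → w (σ x) = w x ∧ SameType k a (σ x) x) := by
      intro x
      by_cases hx : σ x = x
      · rw [hx]; exact ⟨Iff.rfl, fun _ => ⟨rfl, .refl k a x⟩⟩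
      · obtain ⟨h1, h2, h3⟩ := hσ x hx
        obtain ⟨h4, h5, h6⟩ := hσ (σ x) (fun h => hx (σ.injective h))
        exact ⟨iff_of_true h4 h1, fun _ => ⟨h5.trans h2.symm, h6.trans h3.symm⟩⟩
    refine ⟨fun x => c (σ x), fun x => hc _, fun i hi => le_trans (le_of_eq ?_) (hcd i hi)⟩
    have e1 : load a w c i (range L) = ∑ x ∈ range L, w x * mis a (c (σ x)) i x := by
      unfold load
      refine (sum_bij (fun x _ => σ x) (fun x hx => ?_) (fun x _ y _ h => σ.injective h)
        (fun y hy => ⟨σ.symm y, ?_, by simp⟩) (fun x hx => ?_)).symm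
      · exact mem_range.2 ((hσc x).1.2 (mem_range.1 hx))
      · rw [mem_range, ← (hσc _).1]; simpa using hy
      · obtain ⟨h1, h2⟩ := (hσc x).2 (mem_range.1 hx)
        rw [h1, h2.mis_eq (hc _) hi]
    rw [e1]
    unfold load
    have hjm : j ∈ range L := mem_range.2 hj
    have hlm : l ∈ (range L).erase j := mem_erase.2 ⟨hl.ne, mem_range.2 (hl.trans hj)⟩
    rw [← add_sum_erase _ _ hjm, ← add_sum_erase _ _ hlm, ← add_sum_erase (range L) _ hjm,
      ← add_sum_erase _ (fun x => w x * mis a (c (σ x)) i x) hlm, ← add_assoc, ← add_assoc]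
    congr 1
    -- With the same row on `j` and `l`, the doubled weight of `j` contributes exactly what both
    -- groups contributed before.
    · rw [Function.update_self, Function.update_of_ne hl.ne', Function.update_self, zero_mul,
        add_zero, add_mul, hwl]
      simp only [hσj, hσl, hcpq, ht.mis_eq (hc q) hi]
    · refine sum_congr rfl fun x hx => ?_
      rw [Function.update_of_ne (mem_erase.1 hx).1,
        Function.update_of_ne (mem_erase.1 (mem_erase.1 hx).2).1]

/-! ### Capped budgets and partial solutions -/

/-- The total weight of the groups outside `D`. -/
def rest (L : ℕ) (w : ℕ → ℕ) (D : Finset ℕ) : ℕ := ∑ j ∈ range L \ D, w j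

theorem rest_insert {L : ℕ} {w : ℕ → ℕ} {D : Finset ℕ} {j : ℕ} (hj : j < L) (hD : j ∉ D) :
    rest L w D = w j + rest L w (insert j D) := by
  unfold rest
  have : range L \ D = insert j (range L \ insert j D) := by
    ext x
    simp only [mem_sdiff, mem_range, mem_insert]
    constructor
    · intro h; by_cases hx : x = j <;> simp_all
    · rintro (rfl | h)
      · exact ⟨hj, hD⟩
      · exact ⟨h.1, fun h' => h.2 (.inr h')⟩
  rw [this, sum_insert (by simp)]

theorem load_insert {a : ℕ → ℕ → ℕ} {w c : ℕ → ℕ} {i j : ℕ} {D : Finset ℕ} (hD : j ∉ D) :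
    load a w c i (insert j D) = w j * mis a (c j) i j + load a w c i D := sum_insert hD

/-- The choice `c` of rows exceeds no distance bound on the groups in `D`. -/
def Feasible (k d : ℕ) (a : ℕ → ℕ → ℕ) (w : ℕ → ℕ) (D : Finset ℕ) (c : ℕ → ℕ) : Prop :=
  (∀ j, c j < k) ∧ ∀ i < k, load a w c i D ≤ d

/-- The remaining budget for row `i` after the choice `c` on `D`, capped at the remaining
weight. -/
def slack (L d : ℕ) (a : ℕ → ℕ → ℕ) (w : ℕ → ℕ) (D : Finset ℕ) (c : ℕ → ℕ) (i : ℕ) : ℕ :=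
  min (d - load a w c i D) (rest L w D)

/-- A mismatch on group `j` costs at most `w j`, which is part of the remaining weight. So the cap
does not affect the feasibility test, and the new capped budget is computable from the old one
alone. This is the completeness half of a transition. -/
theorem Feasible.slack_insert {k L d : ℕ} {a : ℕ → ℕ → ℕ} {w : ℕ → ℕ} {D : Finset ℕ} {c : ℕ → ℕ}
    {j : ℕ} (hj : j < L) (hD : j ∉ D) (h : Feasible k d a w (insert j D) c) :
    Feasible k d a w D c ∧ ∀ i < k, w j * mis a (c j) i j ≤ slack L d a w D c i ∧
      slack L d a w (insert j D) c i =
        min (slack L d a w D c i - w j * mis a (c j) i j) (rest L w D - w j) := by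
  refine ⟨⟨h.1, fun i hi => ?_⟩, fun i hi => ?_⟩
  · have := h.2 i hi
    rw [load_insert hD] at this
    omega
  · have h1 := h.2 i hi
    rw [load_insert hD] at h1
    have h2 : w j * mis a (c j) i j ≤ w j := by unfold mis; split_ifs <;> simp
    simp only [slack, load_insert hD, rest_insert hj hD]
    omega

/-- `v` and `y` are the budget vector and the (partial) string of a feasible choice on `D`. -/
def Node (k L d : ℕ) (a : ℕ → ℕ → ℕ) (w g : ℕ → ℕ) (D : Finset ℕ) (v y : ℕ → ℕ) : Prop :=
  ∃ c, Feasible k d a w D c ∧ (∀ i < k, v i = slack L d a w D c i) ∧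
    ∀ x < L, g x ∈ D → y x = a (c (g x)) x

/-- The soundness half of a transition: the test on capped budgets implies feasibility for the true
loads, whichever choice witnesses the node. -/
theorem Node.step {k L d : ℕ} {a : ℕ → ℕ → ℕ} {w g : ℕ → ℕ} {D : Finset ℕ} {v y v' y' : ℕ → ℕ}
    (h : Node k L d a w g D v y) {j c₀ : ℕ} (hj : j < L) (hD : j ∉ D) (hc₀ : c₀ < k)
    (hv : ∀ i < k, w j * mis a c₀ i j ≤ v i)
    (hv' : ∀ i < k, v' i = min (v i - w j * mis a c₀ i j) (rest L w D - w j))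
    (hy' : ∀ x < L, y' x = if g x = j then a c₀ x else y x) :
    Node k L d a w g (insert j D) v' y' := by
  obtain ⟨c, ⟨hc, hcd⟩, hcv, hcy⟩ := h
  have hl : ∀ i, load a w (Function.update c j c₀) i (insert j D) =
      w j * mis a c₀ i j + load a w c i D := by
    intro i
    rw [load_insert hD, Function.update_self]
    congr 1
    refine sum_congr rfl fun x hx => ?_
    rw [Function.update_of_ne (ne_of_mem_of_not_mem hx hD)]
  refine ⟨Function.update c j c₀, ⟨fun x => ?_, fun i hi => ?_⟩, fun i hi => ?_, fun x hx hgx => ?_⟩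
  · rcases eq_or_ne x j with rfl | hx
    · rwa [Function.update_self]
    · rw [Function.update_of_ne hx]; exact hc x
  · rw [hl]
    have h1 := hv i hi
    rw [hcv i hi, slack] at h1
    have := hcd i hi
    omega
  · have h2 : w j * mis a c₀ i j ≤ w j := by unfold mis; split_ifs <;> simp
    rw [hv' i hi, hcv i hi, slack, slack, hl, rest_insert hj hD]
    omega
  · rw [hy' x hx]
    split_ifs with h1
    · rw [h1, Function.update_self]
    · rw [Function.update_of_ne h1]
      exact hcy x hx ((mem_insert.1 hgx).resolve_left h1)

/-- Once all nonempty groups are treated, the load of a row is its Hamming distance to the string.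
The second conclusion is what later places the output letters in the alphabet. -/
theorem Node.solution {k L d : ℕ} {a : ℕ → ℕ → ℕ} {w g : ℕ → ℕ} {D : Finset ℕ} {v y : ℕ → ℕ}
    (hG : Grouping k L d a w g) (hD : ∀ j < L, j ∈ D ↔ w j ≠ 0) (hDL : D ⊆ range L)
    (h : Node k L d a w g D v y) :
    (∀ i < k, #{x ∈ range L | y x ≠ a i x} ≤ d) ∧ ∀ x < L, ∃ c < k, y x = a c x := by
  obtain ⟨c, ⟨hc, hcd⟩, -, hcy⟩ := h
  have hgD : ∀ x < L, g x ∈ D := by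
    intro x hx
    rw [hD _ (hG.g_lt x hx), hG.w_eq _ (hG.g_lt x hx), ← Nat.pos_iff_ne_zero, card_pos]
    exact ⟨x, mem_filter.2 ⟨mem_range.2 hx, rfl⟩⟩
  refine ⟨fun i hi => le_trans (le_of_eq ?_) (hcd i hi),
    fun x hx => ⟨c (g x), hc _, hcy x hx (hgD x hx)⟩⟩
  have e1 : load a w c i D = load a w c i (range L) := by
    refine sum_subset hDL fun x hx hxD => ?_
    have := mt (hD x (mem_range.1 hx)).2 hxD
    rw [not_not.1 this, zero_mul]
  -- Split the columns into the fibers of `g`. A column has the type of the column that names its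
  -- group, so the mismatch with row `i` is constant on each fiber.
  rw [e1, card_filter, load, ← sum_fiberwise_of_maps_to (s := range L) (t := range L) (g := g)
    (fun x hx => mem_range.2 (hG.g_lt x (mem_range.1 hx)))]
  refine sum_congr rfl fun j hj => ?_
  rw [hG.w_eq j (mem_range.1 hj), card_eq_sum_ones, sum_mul]
  refine sum_congr rfl fun x hx => ?_
  obtain ⟨hx', rfl⟩ := mem_filter.1 hx
  have hx := mem_range.1 hx'
  rw [one_mul, ← (hG.type x hx).mis_eq (hc _) hi, hcy x hx (hgD x hx)]
  unfold mis
  split_ifs <;> simp_all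

/-! ### Counting budget vectors -/

/-- At most `k` groups of each type have weight `2 ^ u`, and the weights outside `D` are at most `2
^ e`; the powers `2 ^ u` with `u ≤ e` sum to less than `2 ^ (e + 1)`. The map `ty` into `α` is any
encoding fine enough to determine the type. -/
theorem rest_le {k L e : ℕ} {a : ℕ → ℕ → ℕ} {w : ℕ → ℕ} {D : Finset ℕ} {α : Type*} [Fintype α]
    [DecidableEq α] (ty : ℕ → α)
    (hty : ∀ x < L, ∀ y < L, ty x = ty y → SameType k a x y)
    (hpow : ∀ j < L, w j ≠ 0 → ∃ e, w j = 2 ^ e)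
    (hcl : ∀ j < L, w j ≠ 0 → ∀ I : Finset ℕ,
      (∀ i ∈ I, i < j ∧ w i = w j ∧ SameType k a i j) → #I < k)
    (hD : ∀ j < L, j ∉ D → w j ≤ 2 ^ e) :
    rest L w D ≤ 2 * k * Fintype.card α * 2 ^ e := by
  have h1 : ∀ u, #{j ∈ range L | w j = 2 ^ u} ≤ k * Fintype.card α := by
    intro u
    have := card_le_mul_card_image_of_maps_to (s := {j ∈ range L | w j = 2 ^ u})
      (t := (univ : Finset α)) (f := ty) (fun _ _ => mem_univ _) k ?_
    · exact this
    · intro b _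
      set F := {x ∈ ({j ∈ range L | w j = 2 ^ u} : Finset ℕ) | ty x = b} with hF
      rcases F.eq_empty_or_nonempty with h0 | h0
      · rw [h0]; simp
      -- The hypothesis `hcl` counts only groups with a smaller index, so it is applied to the last
      -- group of the class: fewer than `k` others precede it.
      have hm := F.max'_mem h0
      set m := F.max' h0 with hmdef
      have hFm : ∀ x ∈ F, x < L ∧ w x = 2 ^ u ∧ ty x = b := by
        intro x hx
        simpa [hF, and_assoc] using hx
      obtain ⟨m1, m2, m3⟩ := hFm m hm
      have := hcl m m1 (by rw [m2]; positivity) (F.erase m) ?_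
      · rw [card_erase_of_mem hm] at this
        omega
      · intro i hi
        obtain ⟨hi1, hi2⟩ := mem_erase.1 hi
        obtain ⟨i1, i2, i3⟩ := hFm i hi2
        exact ⟨lt_of_le_of_ne (F.le_max' i hi2) hi1, i2.trans m2.symm,
          hty i i1 m m1 (i3.trans m3.symm)⟩
  have h2 : rest L w D ≤ ∑ u ∈ range (e + 1), ∑ j ∈ range L with w j = 2 ^ u, w j := by
    rw [← sum_biUnion]
    · refine le_trans (le_of_eq ?_) (sum_le_sum_of_subset (s := {j ∈ range L \ D | w j ≠ 0}) ?_)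
      · rw [sum_filter_ne_zero]; rfl
      · intro j hj
        simp only [mem_filter, mem_sdiff, mem_range] at hj
        obtain ⟨u, hu⟩ := hpow j hj.1.1 hj.2
        simp only [mem_biUnion, mem_filter, mem_range]
        refine ⟨u, ?_, hj.1.1, hu⟩
        have := hD j hj.1.1 hj.1.2
        rw [hu] at this
        have := (Nat.pow_le_pow_iff_right (by norm_num : 1 < 2)).1 this
        omega
    · intro u _ u' _ huu'
      rw [Function.onFun, disjoint_filter]
      intro x _ h3 h4
      exact huu' (Nat.pow_right_injective le_rfl (h3.symm.trans h4))
  refine h2.trans ?_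
  calc ∑ u ∈ range (e + 1), ∑ j ∈ range L with w j = 2 ^ u, w j
      ≤ ∑ u ∈ range (e + 1), k * Fintype.card α * 2 ^ u := by
        refine sum_le_sum fun u _ => ?_
        rw [sum_congr rfl (fun j hj => (mem_filter.1 hj).2), sum_const, smul_eq_mul]
        exact Nat.mul_le_mul_right _ (h1 u)
    _ = k * Fintype.card α * ∑ u ∈ range (e + 1), 2 ^ u := (mul_sum _ _ _).symm
    _ ≤ k * Fintype.card α * 2 ^ (e + 1) := by
        refine Nat.mul_le_mul_left _ ?_
        rw [Nat.geomSum_eq le_rfl]; simp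
    _ = _ := by ring

/-- A coordinate is either the cap itself or a number below the cap with the residue of `d` modulo
`2 ^ e`, since all loads are multiples of `2 ^ e`. In the second case its quotient by `2 ^ e`
determines it. -/
theorem card_le_of_slack {k L d e N : ℕ} {a : ℕ → ℕ → ℕ} {w : ℕ → ℕ} {D : Finset ℕ}
    (hR : rest L w D ≤ N * 2 ^ e) (hdvd : ∀ j ∈ D, 2 ^ e ∣ w j) (F : Finset (Fin k → ℕ))
    (hF : ∀ v ∈ F, ∃ c, Feasible k d a w D c ∧ ∀ i : Fin k, v i = slack L d a w D c i) :
    #F ≤ (N + 2) ^ k := by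
  set R := rest L w D with hRdef
  -- Quotients are at most `N`, so the code `N + 1` is free for the cap.
  let f : ℕ → ℕ := fun x => if x = R then N + 1 else x / 2 ^ e
  have hpos : 0 < 2 ^ e := by positivity
  have hval : ∀ v ∈ F, ∀ i, v i = R ∨ (v i < R ∧ v i % 2 ^ e = d % 2 ^ e) := by
    intro v hv i
    obtain ⟨c, hc, hcv⟩ := hF v hv
    have hle := hc.2 i i.2
    obtain ⟨m, hm⟩ : 2 ^ e ∣ load a w c i D :=
      dvd_sum fun j hj => (hdvd j hj).mul_right _
    rw [hcv i, slack, ← hRdef]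
    rcases le_or_gt R (d - load a w c i D) with h | h
    · left; exact min_eq_right h
    · right
      rw [min_eq_left h.le]
      refine ⟨h, ?_⟩
      conv_rhs => rw [← Nat.sub_add_cancel hle, hm, Nat.add_mul_mod_self_left]
      rw [hm]
  have hfle : ∀ x ≤ R, f x < N + 2 := by
    intro x hx
    simp only [f]
    split_ifs
    · omega
    · have := Nat.div_le_of_le_mul (hx.trans (hR.trans_eq (mul_comm _ _)))
      omega
  have hinj : ∀ x y, (x = R ∨ (x < R ∧ x % 2 ^ e = d % 2 ^ e)) →
      (y = R ∨ (y < R ∧ y % 2 ^ e = d % 2 ^ e)) → f x = f y → x = y := by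
    have hd : ∀ x < R, x / 2 ^ e ≤ N := fun x hx =>
      Nat.div_le_of_le_mul (hx.le.trans (hR.trans_eq (mul_comm _ _)))
    rintro x y (rfl | ⟨hx, hx'⟩) (rfl | ⟨hy, hy'⟩) hxy
    · rfl
    · simp only [f, if_true, if_neg hy.ne] at hxy
      have := hd y hy; omega
    · simp only [f, if_true, if_neg hx.ne] at hxy
      have := hd x hx; omega
    · simp only [f, if_neg hy.ne, if_neg hx.ne] at hxy
      rw [← Nat.div_add_mod x (2 ^ e), ← Nat.div_add_mod y (2 ^ e), hxy, hx', hy']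
  have := card_le_card_of_injOn (s := F)
    (t := Fintype.piFinset fun _ : Fin k => range (N + 2)) (fun v i => f (v i)) ?_ ?_
  · simpa using this
  · intro v hv
    rw [mem_coe, Fintype.mem_piFinset]
    intro i
    have := hval v hv i
    exact mem_range.2 (hfle _ (by omega))
  · intro v hv v' hv' hvv
    funext i
    exact hinj _ _ (hval v hv i) (hval v' hv' i) (congrFun hvv i)

-- Registers and memory layout

notation "rK" => (0 : ℕ)
notation "rL" => (1 : ℕ)
notation "rD" => (2 : ℕ)
notation "rW" => (4 : ℕ)
notation "rG" => (5 : ℕ)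
notation "rZ" => (6 : ℕ)
notation "rJ" => (7 : ℕ)
notation "rWJ" => (8 : ℕ)
notation "rCnt" => (9 : ℕ)
notation "rLast" => (10 : ℕ)
notation "rEq" => (11 : ℕ)
notation "rPA" => (12 : ℕ)
notation "rPAj" => (13 : ℕ)
notation "rU" => (14 : ℕ)
notation "rUj" => (15 : ℕ)
notation "rPB" => (16 : ℕ)
notation "rPBj" => (17 : ℕ)
notation "rV" => (18 : ℕ)
notation "rVj" => (19 : ℕ)
notation "rE" => (20 : ℕ)
notation "rF" => (21 : ℕ)
notation "rT" => (22 : ℕ)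
notation "rA" => (23 : ℕ)
notation "rAt" => (24 : ℕ)
notation "rB" => (25 : ℕ)
notation "rBt" => (26 : ℕ)
notation "rI" => (27 : ℕ)
notation "rIt" => (28 : ℕ)
notation "rX" => (29 : ℕ)
notation "rXt" => (30 : ℕ)
notation "rR" => (31 : ℕ)
notation "rCur" => (32 : ℕ)
notation "rStart" => (33 : ℕ)
notation "rEnd" => (34 : ℕ)
notation "rP" => (35 : ℕ)
notation "rNC" => (36 : ℕ)
notation "rNN" => (37 : ℕ)
notation "rM" => (38 : ℕ)
notation "rMt" => (39 : ℕ)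
notation "rWW" => (40 : ℕ)
notation "rJt" => (41 : ℕ)
notation "rQ" => (42 : ℕ)
notation "rQt" => (43 : ℕ)
notation "rC" => (44 : ℕ)
notation "rCt" => (45 : ℕ)
notation "rRow" => (46 : ℕ)
notation "rOk" => (47 : ℕ)
notation "rS" => (48 : ℕ)
notation "rH" => (49 : ℕ)
notation "rHt" => (50 : ℕ)

/-- The registers with the parameters and the base addresses of the weights and the group names;
`rZ` holds the size of a node. -/
structure Env (k L d : ℕ) (s : State) : Prop where
  hk : s.reg rK = k
  hL : s.reg rL = L
  hd : s.reg rD = d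
  hW : s.reg rW = k * L
  hG : s.reg rG = k * L + L
  hZ : s.reg rZ = k + L

theorem Env.frame {k L d : ℕ} {s s' : State} {p : Program} (h : Env k L d s) (hf : Frame p s s')
    (hp : ∀ r ∈ [rK, rL, rD, rW, rG, rZ], r ∉ p.writes) : Env k L d s' where
  hk := (hf.reg _ (hp _ (by simp))).trans h.hk
  hL := (hf.reg _ (hp _ (by simp))).trans h.hL
  hd := (hf.reg _ (hp _ (by simp))).trans h.hd
  hW := (hf.reg _ (hp _ (by simp))).trans h.hW
  hG := (hf.reg _ (hp _ (by simp))).trans h.hG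
  hZ := (hf.reg _ (hp _ (by simp))).trans h.hZ

/-- The memory contains the letters `a`, followed by the weights `w` and the group names `g`. -/
structure Data (k L : ℕ) (a : ℕ → ℕ → ℕ) (w g : ℕ → ℕ) (m : ℕ → ℕ) : Prop where
  str : ∀ i < k, ∀ x < L, m (i * L + x) = a i x
  wt : ∀ x < L, m (k * L + x) = w x
  grp : ∀ x < L, m (k * L + L + x) = g x

theorem pos_sub_add_sub_iff {x y : ℕ} : 0 < x - y + (y - x) ↔ x ≠ y := by omega

/-! ### Comparing columns and merging groups on the machine -/

/-- `R[e] > 0` if and only if `R[x] ≠ R[y]`. -/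
def neq (e x y : ℕ) : Program := .sub e x y ;; .sub rT y x ;; .add e e rT

/-- `R[rEq] > 0` if and only if the columns `R[rI]` and `R[rJ]` have the same type. -/
def sameType : Program :=
  (.const rEq 1 ;; .copy rPA rI ;; .copy rPAj rJ) ;;
  forLoop rA rK rAt (
    (.load rU rPA ;; .load rUj rPAj ;; .copy rPB rI ;; .copy rPBj rJ) ;;
    forLoop rB rK rBt (
      .load rV rPB ;; .load rVj rPBj ;; neq rE rU rV ;; neq rF rUj rVj ;;
      .ifPos rE (.ifPos rF .skip (.const rEq 0)) (.ifPos rF (.const rEq 0) .skip) ;;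
      .add rPB rPB rL ;; .add rPBj rPBj rL) ;;
    (.add rPA rPA rL ;; .add rPAj rPAj rL))

/-- All pairs of rows are compared. The pointers advance by `L` from row to row, because the machine
cannot multiply. -/
theorem wp_sameType {k L d : ℕ} {a : ℕ → ℕ → ℕ} {w g : ℕ → ℕ} {s : State} (hE : Env k L d s)
    (hM : Data k L a w g s.mem) {i j : ℕ} (hi : s.reg rI = i) (hj : s.reg rJ = j)
    (hiL : i < L) (hjL : j < L) :
    wp sameType (k * (k * 17 + 13) + 6) (fun s' => 0 < s'.reg rEq ↔ SameType k a i j) s := by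
  refine wp.seq (T₁ := 3) (T₂ := k * (k * 17 + 9 + 4) + 3)
    (Q₁ := fun s' => s'.reg rEq = 1 ∧ s'.reg rPA = i ∧ s'.reg rPAj = j)
    (wp_of_loopFree rfl le_rfl ?_) ?_ (by linarith)
  · simp [Program.run, State.setReg, hi, hj]
  rintro s1 hf1 ⟨e1, e2, e3⟩
  refine wp_for k (k * 17 + 9) (fun m s' => s'.reg rPA = m * L + i ∧ s'.reg rPAj = m * L + j ∧
    (0 < s'.reg rEq ↔ ∀ p < m, ∀ q < k, (a p i = a q i ↔ a p j = a q j)))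
    ((hE.frame hf1 (by decide)).hk) (by decide) (by decide) (fun m s v h => ⟨h, h⟩)
    (by simp [e1, e2, e3]) ?_ (fun s' _ h => h.2.2) le_rfl
  rintro p hp s2 hf2 - ⟨i1, i2, i3⟩
  have hE2 := (hE.frame hf1 (by decide)).frame hf2 (by decide)
  have hm2 : s2.mem = s.mem := by rw [hf2.mem (by decide), hf1.mem (by decide)]
  refine wp.seq (T₁ := 4) (T₂ := k * (13 + 4) + 3 + 2) (Q₁ := fun s' => s'.reg rU = a p i ∧
    s'.reg rUj = a p j ∧ s'.reg rPB = i ∧ s'.reg rPBj = j) (wp_of_loopFree rfl le_rfl ?_) ?_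
    (by omega)
  · have f1 : s2.reg rI = i := by rw [hf2.reg _ (by decide), hf1.reg _ (by decide), hi]
    have f2 : s2.reg rJ = j := by rw [hf2.reg _ (by decide), hf1.reg _ (by decide), hj]
    simp [Program.run, State.setReg, f1, f2, i1, i2, hm2,
      hM.str p hp i hiL, hM.str p hp j hjL]
  rintro s3 hf3 ⟨e1, e2, e3, e4⟩
  have hE3 := hE2.frame hf3 (by decide)
  have hm3 : s3.mem = s.mem := by rw [hf3.mem (by decide), hm2]
  refine wp.seq (T₁ := k * (13 + 4) + 3) (T₂ := 2) (Q₁ := fun s' =>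
    (0 < s'.reg rEq ↔ ∀ m < p + 1, ∀ q < k, (a m i = a q i ↔ a m j = a q j))) ?_ ?_ le_rfl
  · refine wp_for k 13 (fun m s' => s'.reg rPB = m * L + i ∧ s'.reg rPBj = m * L + j ∧
      (0 < s'.reg rEq ↔ 0 < s2.reg rEq ∧ ∀ q < m, (a p i = a q i ↔ a p j = a q j)))
      hE3.hk (by decide) (by decide) (fun m s v h => ⟨h, h⟩) ?_ ?_ ?_ le_rfl
    · simp [e3, e4, hf3.reg rEq (by decide)]
    · rintro q hq s4 hf4 - ⟨j1, j2, j3⟩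
      have hE4 := hE3.frame hf4 (by decide)
      have hm4 : s4.mem = s.mem := by rw [hf4.mem (by decide), hm3]
      refine wp_of_loopFree rfl (by decide) ?_
      have g1 : s4.reg rU = a p i := by rw [hf4.reg _ (by decide), e1]
      have g2 : s4.reg rUj = a p j := by rw [hf4.reg _ (by decide), e2]
      simp only [Nat.forall_lt_succ_right, ← and_assoc, ← j3]
      simp only [Program.run, neq, State.setReg, Function.update_apply, j1, j2, hm4, g1, g2,
        hM.str q hq i hiL, hM.str q hq j hjL, Nat.reduceEqDiff, if_true, if_false,
        pos_sub_add_sub_iff]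
      split_ifs <;> simp [hE4.hL, *, Nat.succ_mul] <;> omega
    · rintro s' - ⟨-, -, h⟩
      simp only [Nat.forall_lt_succ_right]
      rw [h, i3]
  · rintro s4 hf4 h
    refine wp_of_loopFree rfl le_rfl ?_
    have hE4 := hE3.frame hf4 (by decide)
    simp [Program.run, State.setReg, hE4.hL, h, Nat.succ_mul, hf4.reg rPA (by decide),
      hf4.reg rPAj (by decide), hf3.reg rPA (by decide), hf3.reg rPAj (by decide), i1, i2]
    omega

theorem mul_add_lt {k L i x : ℕ} (hi : i < k) (hx : x < L) : i * L + x < k * L :=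
  calc i * L + x < i * L + L := by omega
    _ = (i + 1) * L := by ring
    _ ≤ k * L := Nat.mul_le_mul_right _ hi

theorem Data.of_eq {k L : ℕ} {a : ℕ → ℕ → ℕ} {w g w' g' m m' : ℕ → ℕ} (h : Data k L a w g m)
    (hm : ∀ x < k * L + L + L, m' x = m x) (hw : ∀ x < L, w' x = w x) (hg : ∀ x < L, g' x = g x) :
    Data k L a w' g' m' where
  str i hi x hx := by
    have := mul_add_lt hi hx
    rw [hm _ (by omega), h.str i hi x hx]
  wt x hx := by rw [hm _ (by omega), hw x hx, h.wt x hx]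
  grp x hx := by rw [hm _ (by omega), hg x hx, h.grp x hx]

theorem Data.store_wt {k L : ℕ} {a : ℕ → ℕ → ℕ} {w g m : ℕ → ℕ} (h : Data k L a w g m) {x : ℕ}
    (hx : x < L) (v : ℕ) :
    Data k L a (Function.update w x v) g (Function.update m (k * L + x) v) where
  str i hi y hy := by
    have := mul_add_lt hi hy
    rw [Function.update_of_ne (by omega), h.str i hi y hy]
  wt y hy := by
    rcases eq_or_ne y x with rfl | hyx
    · simp
    · rw [Function.update_of_ne (by omega), Function.update_of_ne hyx, h.wt y hy]
  grp y hy := by rw [Function.update_of_ne (by omega), h.grp y hy]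

theorem Data.store_grp {k L : ℕ} {a : ℕ → ℕ → ℕ} {w g m : ℕ → ℕ} (h : Data k L a w g m) {x : ℕ}
    (hx : x < L) (v : ℕ) :
    Data k L a w (Function.update g x v) (Function.update m (k * L + L + x) v) where
  str i hi y hy := by
    have := mul_add_lt hi hy
    rw [Function.update_of_ne (by omega), h.str i hi y hy]
  wt y hy := by rw [Function.update_of_ne (by omega), h.wt y hy]
  grp y hy := by
    rcases eq_or_ne y x with rfl | hyx
    · simp
    · rw [Function.update_of_ne (by omega), Function.update_of_ne hyx, h.grp y hy]

/-- Count the `i < R[rJ]` with the same type and weight as `R[rJ]`; `rLast` is the last of them. -/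
def countSame : Program :=
  .const rCnt 0 ;;
  forLoop rI rJ rIt (
    (.add rT rW rI ;; .load rV rT ;; neq rE rV rWJ) ;;
    .ifPos rE .skip (
      sameType ;;
      .ifPos rEq (.const rT 1 ;; .add rCnt rCnt rT ;; .copy rLast rI) .skip))

/-- A bound for the running time of `sameType`. -/
def sameTypeTime (k : ℕ) : ℕ := k * (k * 17 + 13) + 6

theorem wp_countSame {k L d : ℕ} {a : ℕ → ℕ → ℕ} {w g : ℕ → ℕ} {s : State} (hE : Env k L d s)
    (hM : Data k L a w g s.mem) {j : ℕ} (hj : s.reg rJ = j) (hjL : j < L) (hwj : s.reg rWJ = w j) :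
    wp countSame (L * (sameTypeTime k + 14) + 4) (fun s' => ∃ I : Finset ℕ, #I = s'.reg rCnt ∧
      (∀ i, i ∈ I ↔ i < j ∧ w i = w j ∧ SameType k a i j) ∧ (I.Nonempty → s'.reg rLast ∈ I)) s := by
  refine wp.seq (T₁ := 1) (T₂ := L * (sameTypeTime k + 10 + 4) + 3)
    (Q₁ := fun s' => s'.reg rCnt = 0) (wp_of_loopFree rfl le_rfl rfl) ?_ (by linarith)
  rintro s1 hf1 e1
  have hE1 := hE.frame hf1 (by decide)
  refine wp_for j (sameTypeTime k + 10) (fun m s' => ∃ I : Finset ℕ, #I = s'.reg rCnt ∧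
      (∀ i, i ∈ I ↔ i < m ∧ w i = w j ∧ SameType k a i j) ∧ (I.Nonempty → s'.reg rLast ∈ I))
    ((hf1.reg _ (by decide)).trans hj) (by decide) (by decide) (fun m s v h => ⟨h, h⟩)
    ⟨∅, by simp [e1]⟩ ?_ (fun s' _ h => h)
    (Nat.add_le_add_right (Nat.mul_le_mul_right _ hjL.le) _)
  rintro i hi s2 hf2 hri ⟨I, i1, i2, i3⟩
  have hE2 := hE1.frame hf2 (by decide)
  have hm2 : s2.mem = s.mem := by rw [hf2.mem (by decide), hf1.mem (by decide)]
  have hiL := hi.trans hjL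
  refine wp.seq (T₁ := 5) (T₂ := sameTypeTime k + 4 + 1) (Q₁ := fun s' =>
    0 < s'.reg rE ↔ w i ≠ w j) (wp_of_loopFree rfl le_rfl ?_) ?_ (by omega)
  · have f2 : s2.reg rWJ = w j := by rw [hf2.reg _ (by decide), hf1.reg _ (by decide), hwj]
    simp [Program.run, neq, State.setReg, hri, f2, hE2.hW, hm2, hM.wt i hiL, eq_comm]
  intro s3 hf3 e3
  have hE3 := hE2.frame hf3 (by decide)
  have hm3 : s3.mem = s.mem := by rw [hf3.mem (by decide), hm2]
  refine wp.ifPos (T := sameTypeTime k + 4) (fun h => ?_) (fun h => ?_) le_rfl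
  · refine wp_of_loopFree rfl (by simp [Program.cost]) ?_
    refine ⟨I, ?_, fun x => ?_, ?_⟩
    · simp [Program.run, i1, hf3.reg rCnt (by decide)]
    · rw [i2, Nat.lt_succ_iff_lt_or_eq]
      constructor
      · rintro ⟨h1, h2⟩; exact ⟨.inl h1, h2⟩
      · rintro ⟨h1 | rfl, h2⟩
        · exact ⟨h1, h2⟩
        · exact absurd h2.1 (e3.1 h)
    · simpa [Program.run, hf3.reg rLast (by decide)] using i3
  · have hw : w i = w j := by
      by_contra hc; have := e3.2 hc; omega
    refine wp.seq (wp_sameType hE3 (hm3 ▸ hM) (i := i) (j := j) ?_ ?_ hiL hjL) ?_ (T₂ := 4) le_rfl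
    · rw [hf3.reg _ (by decide), hri]
    · rw [hf3.reg _ (by decide), hf2.reg _ (by decide), hf1.reg _ (by decide), hj]
    intro s4 hf4 h4
    have g1 : s4.reg rCnt = s2.reg rCnt := by rw [hf4.reg _ (by decide), hf3.reg _ (by decide)]
    have g2 : s4.reg rLast = s2.reg rLast := by rw [hf4.reg _ (by decide), hf3.reg _ (by decide)]
    have g3 : s4.reg rI = i := by rw [hf4.reg _ (by decide), hf3.reg _ (by decide), hri]
    refine wp.ifPos (T := 3) (fun h => ?_) (fun h => ?_) le_rfl
    · refine wp_of_loopFree rfl le_rfl ⟨insert i I, ?_, fun x => ?_, ?_⟩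
      · rw [card_insert_of_notMem (by simp [i2]), i1]
        simp [Program.run, State.setReg, g1]
      · rw [mem_insert, i2, Nat.lt_succ_iff_lt_or_eq]
        constructor
        · rintro (rfl | ⟨h1, h2⟩)
          · exact ⟨.inr rfl, hw, h4.1 h⟩
          · exact ⟨.inl h1, h2⟩
        · rintro ⟨h1 | rfl, h2⟩
          · exact .inr ⟨h1, h2⟩
          · exact .inl rfl
      · intro _
        simp [Program.run, State.setReg, g3]
    · refine wp_of_loopFree rfl (by simp [Program.cost]) ⟨I, ?_, fun x => ?_, ?_⟩
      · simp [Program.run, i1, g1]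
      · rw [i2, Nat.lt_succ_iff_lt_or_eq]
        constructor
        · rintro ⟨h1, h2⟩; exact ⟨.inl h1, h2⟩
        · rintro ⟨h1 | rfl, h2⟩
          · exact ⟨h1, h2⟩
          · have := h4.2 h2.2; omega
      · simpa [Program.run, g2] using i3

/-- Merge the group `R[rLast]` into the group `R[rJ]` of the same weight `R[rWJ]`. -/
def mergeGroups : Program :=
  (.add rPA rW rJ ;; .add rV rWJ rWJ ;; .store rPA rV ;;
    .add rPA rW rLast ;; .const rV 0 ;; .store rPA rV) ;;
  forLoop rX rL rXt
    (.add rPA rG rX ;; .load rV rPA ;; neq rE rV rLast ;; .ifPos rE .skip (.store rPA rJ))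

theorem wp_mergeGroups {k L d : ℕ} {a : ℕ → ℕ → ℕ} {w g : ℕ → ℕ} {s : State} (hE : Env k L d s)
    (hM : Data k L a w g s.mem) {j l : ℕ} (hj : s.reg rJ = j) (hl : s.reg rLast = l) (hjL : j < L)
    (hlL : l < L) (hwj : s.reg rWJ = w j) :
    wp mergeGroups (L * 11 + 9) (fun s' =>
      Data k L a (Function.update (Function.update w j (w j + w j)) l 0)
        (fun x => if g x = l then j else g x) s'.mem) s := by
  set w' := Function.update (Function.update w j (w j + w j)) l 0 with hw'
  refine wp.seq (T₁ := 6) (T₂ := L * (7 + 4) + 3) (Q₁ := fun s' => Data k L a w' g s'.mem)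
    (wp_of_loopFree rfl le_rfl ?_) ?_ (by omega)
  · have := (hM.store_wt hjL (w j + w j)).store_wt hlL 0
    simpa [Program.run, State.setReg, State.setMem, hj, hl, hE.hW, hwj] using this
  intro s1 hf1 hM1
  have hE1 := hE.frame hf1 (by decide)
  -- After `m` iterations only the first `m` columns have been renamed.
  refine wp_for L 7 (fun m s' => Data k L a w' (fun x => if x < m ∧ g x = l then j else g x) s'.mem)
    hE1.hL (by decide) (by decide) (fun m s v h => ⟨h, h⟩) (by simpa using hM1) ?_
    (fun s' _ h => h.of_eq (fun _ _ => rfl) (fun _ _ => rfl) fun x hx => by simp [hx]) le_rfl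
  rintro x hx s2 hf2 hrx hM2
  have hE2 := hE1.frame hf2 (by decide)
  refine wp_of_loopFree rfl (by decide) ?_
  have f1 : s2.reg rJ = j := by rw [hf2.reg _ (by decide), hf1.reg _ (by decide), hj]
  have f2 : s2.reg rLast = l := by rw [hf2.reg _ (by decide), hf1.reg _ (by decide), hl]
  have f3 : s2.mem (k * L + L + x) = g x := by rw [hM2.grp x hx]; simp
  have h3 := hM2.store_grp hx j
  by_cases hgx : g x = l
  · refine Data.of_eq h3 ?_ (fun _ _ => rfl) fun y hy => ?_
    · simp [Program.run, neq, State.setReg, State.setMem, hrx, f1, f2, hE2.hG, f3, hgx]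
    · rw [Function.update_apply]
      split_ifs <;> first | rfl | (exfalso; grind)
  · refine Data.of_eq hM2 ?_ (fun _ _ => rfl) fun y hy => ?_
    · simp [Program.run, neq, State.setReg, hrx, f2, hE2.hG, f3,
        Ne.symm hgx]
    · split_ifs <;> first | rfl | (exfalso; grind)

/-- Merge groups of the same type and weight as long as there are more than `R[rK]` of them. -/
def mergeAll : Program :=
  (.const rJ 0 ;; .copy rM rL) ;;
  .whilePos rM (
    (.add rPA rW rJ ;; .load rWJ rPA) ;;
    .ifPos rWJ
      (countSame ;; .sub rV rK rCnt ;;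
        .ifPos rV (.const rT 1 ;; .add rJ rJ rT) (mergeGroups ;; .const rJ 0))
      (.const rT 1 ;; .add rJ rJ rT) ;;
    .sub rM rL rJ)

/-- At most `k` of the first `j` groups have the same type and the same positive weight. -/
def Reduced (k : ℕ) (a : ℕ → ℕ → ℕ) (w : ℕ → ℕ) (j : ℕ) : Prop :=
  ∀ j' < j, w j' ≠ 0 → ∀ I : Finset ℕ, (∀ i ∈ I, i < j' ∧ w i = w j' ∧ SameType k a i j') → #I < k

/-- A bound for the running time of one iteration of `mergeAll`. -/
def mergeTime (k L : ℕ) : ℕ := L * (sameTypeTime k + 14) + L * 11 + 20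

/-- The scan over `j` restarts from 0 after every merge, because the changed weights can create new
full classes. -/
theorem wp_mergeAll {k L d : ℕ} {a : ℕ → ℕ → ℕ} {w g : ℕ → ℕ} {s : State} (hE : Env k L d s)
    (hM : Data k L a w g s.mem) (hG : Grouping k L d a w g) (hk : 0 < k) :
    wp mergeAll ((L * (L + 1) + L) * (mergeTime k L + 1) + 3) (fun s' => ∃ w g,
      Data k L a w g s'.mem ∧ Grouping k L d a w g ∧ Reduced k a w L) s := by
  refine wp.seq (T₁ := 2) (T₂ := (L * (L + 1) + L) * (mergeTime k L + 1) + 1)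
    (Q₁ := fun s' => s'.reg rJ = 0 ∧ s'.reg rM = L) (wp_of_loopFree rfl le_rfl ?_) ?_ (by omega)
  · simp [Program.run, State.setReg, hE.hL]
  rintro s1 hf1 ⟨e1, e2⟩
  have hE1 := hE.frame hf1 (by decide)
  have hm1 : s1.mem = s.mem := hf1.mem (by decide)
  -- The variant is lexicographic: first the number of nonempty groups, then the distance of the
  -- scan from its end. The factor `L + 1` lets the group lost in a merge pay for a restart of up to
  -- `L` scan steps.
  let Inv : ℕ → State → Prop := fun n s' => Env k L d s' ∧ ∃ w g j, Data k L a w g s'.mem ∧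
    Grouping k L d a w g ∧ Reduced k a w j ∧ j ≤ L ∧ s'.reg rJ = j ∧ s'.reg rM = L - j ∧
    n = #{x ∈ range L | w x ≠ 0} * (L + 1) + (L - j)
  refine wp.mono (wp_while (T := mergeTime k L) Inv ?_ (#{x ∈ range L | w x ≠ 0} * (L + 1) + L) s1
    ⟨hE1, w, g, 0, hm1 ▸ hM, hG, fun j hj => absurd hj (by omega), by omega, e1, e2, rfl⟩) ?_ ?_
  · rintro n s2 ⟨hE2, w, g, j, hM2, hG2, hR, hjL, hrj, hrM, rfl⟩ hpos
    have hjL : j < L := by omega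
    have hadv : ∀ s' : State, Env k L d s' → Data k L a w g s'.mem → Reduced k a w (j + 1) →
        s'.reg rJ = j + 1 → s'.reg rM = L - (j + 1) →
        ∃ m < #{x ∈ range L | w x ≠ 0} * (L + 1) + (L - j), Inv m s' :=
      fun s' h1 h2 h3 h4 h5 => ⟨_, by omega, h1, w, g, j + 1, h2, hG2, h3, hjL, h4, h5, rfl⟩
    refine wp.seq (T₁ := 2) (T₂ := L * (sameTypeTime k + 14) + L * 11 + 18)
      (Q₁ := fun s' => s'.reg rWJ = w j) (wp_of_loopFree rfl le_rfl ?_) ?_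
      (by unfold mergeTime; omega)
    · simp [Program.run, State.setReg, hE2.hW, hrj, hM2.wt j hjL]
    intro s3 hf3 h3
    have hE3 := hE2.frame hf3 (by decide)
    have hm3 : s3.mem = s2.mem := hf3.mem (by decide)
    have hrj3 : s3.reg rJ = j := (hf3.reg _ (by decide)).trans hrj
    refine wp.seq (T₁ := L * (sameTypeTime k + 14) + L * 11 + 17) (T₂ := 1) (Q₁ := fun s' =>
      Env k L d s' ∧ ∃ m < #{x ∈ range L | w x ≠ 0} * (L + 1) + (L - j),
        Inv m (s'.setReg rM (L - s'.reg rJ))) ?_ ?_ (by omega)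
    · refine wp.ifPos (T := L * (sameTypeTime k + 14) + L * 11 + 16) (fun h => ?_) (fun h => ?_)
        (by omega)
      · refine wp.seq (wp_countSame hE3 (hm3 ▸ hM2) hrj3 hjL h3) ?_ (T₂ := L * 11 + 12) (by omega)
        rintro s4 hf4 ⟨I, i1, i2, i3⟩
        have hE4 := hE3.frame hf4 (by decide)
        have hm4 : s4.mem = s2.mem := (hf4.mem (by decide)).trans hm3
        refine wp.seq (T₁ := 1) (T₂ := L * 11 + 11) (Q₁ := fun s' => s'.reg rV = k - #I)
          (wp_of_loopFree rfl le_rfl ?_) ?_ (by omega)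
        · simp [Program.run, State.setReg, hE4.hk, i1]
        intro s5 hf5 h5
        have hE5 := hE4.frame hf5 (by decide)
        have hm5 : s5.mem = s2.mem := (hf5.mem (by decide)).trans hm4
        have hrj5 : s5.reg rJ = j := by rw [hf5.reg _ (by decide), hf4.reg _ (by decide), hrj3]
        refine wp.ifPos (T := L * 11 + 10) (fun h6 => ?_) (fun h6 => ?_) (by omega)
        · refine wp.mono (T := 2) (Q := fun s' => s'.reg rJ = j + 1)
            (wp_of_loopFree rfl le_rfl ?_) (by omega) fun s6 hf6 h7 => ?_
          · simp [Program.run, State.setReg, hrj5]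
          · have hE6 := hE5.frame hf6 (by decide)
            refine ⟨hE6, hadv _ ⟨hE6.1, hE6.2, hE6.3, hE6.4, hE6.5, hE6.6⟩ ?_ ?_ h7 ?_⟩
            · show Data k L a w g s6.mem
              rw [hf6.mem (by decide), hm5]; exact hM2
            · intro j' hj' hw' J hJ
              rcases Nat.lt_succ_iff_lt_or_eq.1 hj' with h8 | rfl
              · exact hR j' h8 hw' J hJ
              -- The counted set `I` contains every admissible `J`, so the test `#I < k` certifies
              -- the new index.
              · refine lt_of_le_of_lt (card_le_card fun x hx => (i2 x).2 (hJ x hx)) ?_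
                omega
            · rw [h7]; rfl
        · have hkI : k ≤ #I := by omega
          have hl := i3 (card_pos.1 (hk.trans_le hkI))
          set l := s4.reg rLast with hldef
          obtain ⟨l1, l2, l3⟩ := (i2 l).1 hl
          have hwj : w j ≠ 0 := by omega
          refine wp.seq (T₂ := 1) (wp_mergeGroups hE5 (hm5 ▸ hM2) hrj5
            (hf5.reg _ (by decide)) hjL (l1.trans hjL) ?_) ?_ (by omega)
          · rw [hf5.reg _ (by decide), hf4.reg _ (by decide), h3]
          intro s6 hf6 hM6
          have hE6 := hE5.frame hf6 (by decide)
          refine wp.mono (T := 1) (Q := fun s' => s'.reg rJ = 0) (wp_of_loopFree rfl le_rfl rfl)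
            le_rfl fun s7 hf7 h7 => ?_
          have hE7 := hE6.frame hf7 (by decide)
          refine ⟨hE7, _, ?_, ⟨hE7.1, hE7.2, hE7.3, hE7.4, hE7.5, hE7.6⟩, _, _, 0, ?_,
            hG2.merge hjL l1 l3 l2 hwj I hkI fun i hi => (i2 i).1 hi,
            fun j hj => absurd hj (by omega), by omega, h7, ?_, rfl⟩
          · have hlt : #{x ∈ range L | Function.update (Function.update w j (w j + w j)) l 0 x ≠ 0}
                < #{x ∈ range L | w x ≠ 0} := by
              apply card_lt_card
              rw [ssubset_iff_of_subset]
              · refine ⟨l, ?_, by simp⟩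
                simp [l1.trans hjL, l2, hwj]
              · intro x hx
                simp only [mem_filter, mem_range, Function.update_apply] at hx ⊢
                refine ⟨hx.1, fun h0 => hx.2 ?_⟩
                split_ifs with c1 c2
                · rfl
                · subst c2; exact absurd h0 hwj
                · exact h0
            have : (#{x ∈ range L |
                Function.update (Function.update w j (w j + w j)) l 0 x ≠ 0} + 1) * (L + 1) ≤
                #{x ∈ range L | w x ≠ 0} * (L + 1) := Nat.mul_le_mul_right _ hlt
            rw [add_mul] at this
            omega
          · show Data k L a _ _ s7.mem
            rw [hf7.mem (by decide)]; exact hM6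
          · rw [h7]; rfl
      · refine wp.mono (T := 2) (Q := fun s' => s'.reg rJ = j + 1)
          (wp_of_loopFree rfl le_rfl ?_) (by omega) fun s6 hf6 h7 => ?_
        · simp [Program.run, State.setReg, hrj3]
        · have hE6 := hE3.frame hf6 (by decide)
          refine ⟨hE6, hadv _ ⟨hE6.1, hE6.2, hE6.3, hE6.4, hE6.5, hE6.6⟩ ?_ ?_ h7 ?_⟩
          · show Data k L a w g s6.mem
            rw [hf6.mem (by decide), hm3]; exact hM2
          · intro j' hj' hw' J hJ
            rcases Nat.lt_succ_iff_lt_or_eq.1 hj' with h8 | rfl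
            · exact hR j' h8 hw' J hJ
            · omega
          · rw [h7]; rfl
    · rintro s4 hf4 ⟨hE4, m, hm, hI⟩
      refine wp_of_loopFree rfl le_rfl ⟨m, hm, ?_⟩
      simpa [Program.run, hE4.hL] using hI
  · have : #{x ∈ range L | w x ≠ 0} ≤ L := (card_filter_le _ _).trans (by simp)
    gcongr
  · rintro s' - ⟨⟨n, hE', w, g, j, h1, h2, h3, h4, h5, h6, h7⟩, h8⟩
    obtain rfl : j = L := by omega
    exact ⟨w, g, h1, h2, h3⟩

/-! ### Expanding a list of nodes -/

/-- Compute the budget vector of the successor of the node at `R[rP]` for the choice of the row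
with letter `R[rS]`, and whether the choice is feasible. -/
def stepVec : Program :=
  (.copy rPA rP ;; .copy rPB rEnd ;; .copy rPAj rJ) ;;
  forLoop rI rK rIt (
    (.load rV rPA ;; .load rU rPAj ;; neq rE rU rS ;;
      .ifPos rE (.sub rT rWJ rV ;; .ifPos rT (.const rOk 0) .skip ;; .sub rV rV rWJ) .skip ;;
      .sub rT rV rR ;; .sub rV rV rT) ;;
    .store rPB rV ;; .const rT 1 ;; .add rPA rPA rT ;; .add rPB rPB rT ;; .add rPAj rPAj rL)

theorem wp_stepVec {k L d : ℕ} {a : ℕ → ℕ → ℕ} {w g : ℕ → ℕ} {s : State} (hE : Env k L d s)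
    (hM : Data k L a w g s.mem) {c j p e r : ℕ} (hj : s.reg rJ = j) (hjL : j < L)
    (hwj : s.reg rWJ = w j) (hp : s.reg rP = p) (he : s.reg rEnd = e) (hr : s.reg rR = r)
    (hs : s.reg rS = a c j) (hok : s.reg rOk = 1) (hpe : p + k ≤ e) (hbe : k * L + L + L ≤ e) :
    wp stepVec (k * 21 + 6) (fun s' => (∀ x < e, s'.mem x = s.mem x) ∧
      (0 < s'.reg rOk ↔ ∀ i < k, w j * mis a c i j ≤ s.mem (p + i)) ∧
      ∀ i < k, s'.mem (e + i) = min (s.mem (p + i) - w j * mis a c i j) r) s := by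
  refine wp.seq (T₁ := 3) (T₂ := k * (17 + 4) + 3)
    (Q₁ := fun s' => s'.reg rPA = p ∧ s'.reg rPB = e ∧ s'.reg rPAj = j)
    (wp_of_loopFree rfl le_rfl ?_) ?_ (by omega)
  · simp [Program.run, State.setReg, hp, he, hj]
  rintro s1 hf1 ⟨e1, e2, e3⟩
  have hE1 := hE.frame hf1 (by decide)
  have hm1 : s1.mem = s.mem := hf1.mem (by decide)
  refine wp_for k 17 (fun m s' => s'.reg rPA = p + m ∧ s'.reg rPB = e + m ∧
      s'.reg rPAj = m * L + j ∧ (∀ x < e, s'.mem x = s.mem x) ∧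
      (0 < s'.reg rOk ↔ ∀ i < m, w j * mis a c i j ≤ s.mem (p + i)) ∧
      ∀ i < m, s'.mem (e + i) = min (s.mem (p + i) - w j * mis a c i j) r)
    hE1.hk (by decide) (by decide) (fun m s v h => ⟨h, h⟩) ?_ ?_
    (fun s' _ h => h.2.2.2) le_rfl
  · simp [e1, e2, e3, hm1, hf1.reg rOk (by decide), hok]
  rintro m hm s2 hf2 - ⟨i1, i2, i3, i4, i5, i6⟩
  have hE2 := hE1.frame hf2 (by decide)
  have f1 : s2.reg rWJ = w j := by rw [hf2.reg _ (by decide), hf1.reg _ (by decide), hwj]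
  have f2 : s2.reg rR = r := by rw [hf2.reg _ (by decide), hf1.reg _ (by decide), hr]
  have f3 : s2.reg rS = a c j := by rw [hf2.reg _ (by decide), hf1.reg _ (by decide), hs]
  have f4 : s2.mem (p + m) = s.mem (p + m) := i4 _ (by omega)
  have f5 : s2.mem (m * L + j) = a m j := by
    have := mul_add_lt hm hjL
    rw [i4 _ (by omega), hM.str m hm j hjL]
  refine wp.seq (T₁ := 12) (T₂ := 5) (Q₁ := fun s' =>
    s'.reg rV = min (s.mem (p + m) - w j * mis a c m j) r ∧
    (0 < s'.reg rOk ↔ 0 < s2.reg rOk ∧ w j * mis a c m j ≤ s.mem (p + m)))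
    (wp_of_loopFree rfl (by decide) ?_) ?_ le_rfl
  -- The minimum is computed by two truncated subtractions.
  · have hmin : ∀ x : ℕ, x - (x - r) = min x r := fun x => by omega
    by_cases h : a c j = a m j
    · simp [Program.run, neq, State.setReg, i1, i3, f2, f3, f4, f5, mis, h, hmin]
    · by_cases h' : w j ≤ s.mem (p + m)
      · simp [Program.run, neq, State.setReg, i1, i3, f1, f2, f3, f4, f5, mis, h, hmin,
          h', Nat.sub_eq_zero_of_le h']
      · have h'' : 0 < w j - s.mem (p + m) := by omega
        simp [Program.run, neq, State.setReg, i1, i3, f1, f2, f3, f4, f5, mis, h, hmin,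
          h', h'']
  rintro s3 hf3 ⟨e1, e2⟩
  have hE3 := hE2.frame hf3 (by decide)
  have hm3 : s3.mem = s2.mem := hf3.mem (by decide)
  have g1 : s3.reg rPA = p + m := by rw [hf3.reg _ (by decide), i1]
  have g2 : s3.reg rPB = e + m := by rw [hf3.reg _ (by decide), i2]
  have g3 : s3.reg rPAj = m * L + j := by rw [hf3.reg _ (by decide), i3]
  refine wp_of_loopFree rfl le_rfl ?_
  simp only [Nat.forall_lt_succ_right]
  simp only [Program.run, State.setReg, State.setMem, Function.update_apply, g1, g2, g3, e1, hm3,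
    hE3.hL, Nat.reduceEqDiff, if_true, if_false]
  refine ⟨by ring, by ring, by ring, fun x hx => ?_, by rw [e2, i5], fun i hi => ?_, trivial⟩
  · rw [if_neg (by omega), i4 x hx]
  · rw [if_neg (by omega), i6 i hi]

/-- Compute the string of the successor of the node at `R[rP]`: on the group `R[rJ]`, copy the row
at the address `R[rRow]`. -/
def copyStr : Program :=
  (.add rPA rP rK ;; .add rPB rEnd rK) ;;
  forLoop rX rL rXt (
    (.add rPAj rG rX ;; .load rU rPAj ;; neq rE rU rJ ;; .add rPAj rPA rX ;;
      .ifPos rE .skip (.add rPAj rRow rX) ;; .load rV rPAj ;; .add rPAj rPB rX) ;;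
    .store rPAj rV)

theorem wp_copyStr {k L d : ℕ} {a : ℕ → ℕ → ℕ} {w g : ℕ → ℕ} {s : State} (hE : Env k L d s)
    (hM : Data k L a w g s.mem) {c j p e : ℕ} (hj : s.reg rJ = j) (hc : c < k)
    (hp : s.reg rP = p) (he : s.reg rEnd = e) (hrow : s.reg rRow = c * L)
    (hpe : p + k + L ≤ e) (hbe : k * L + L + L ≤ e) :
    wp copyStr (L * 15 + 5) (fun s' => (∀ x < e + k, s'.mem x = s.mem x) ∧
      ∀ x < L, s'.mem (e + k + x) = if g x = j then a c x else s.mem (p + k + x)) s := by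
  refine wp.seq (T₁ := 2) (T₂ := L * (11 + 4) + 3)
    (Q₁ := fun s' => s'.reg rPA = p + k ∧ s'.reg rPB = e + k)
    (wp_of_loopFree rfl le_rfl ?_) ?_ (by omega)
  · simp [Program.run, State.setReg, hp, he, hE.hk]
  rintro s1 hf1 ⟨e1, e2⟩
  have hE1 := hE.frame hf1 (by decide)
  have hm1 : s1.mem = s.mem := hf1.mem (by decide)
  refine wp_for L 11 (fun m s' => (∀ x < e + k, s'.mem x = s.mem x) ∧
      ∀ x < m, s'.mem (e + k + x) = if g x = j then a c x else s.mem (p + k + x))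
    hE1.hL (by decide) (by decide) (fun m s v h => ⟨h, h⟩) ?_ ?_ (fun s' _ h => h) le_rfl
  · simp [hm1]
  rintro m hm s2 hf2 hrx ⟨i1, i2⟩
  have hE2 := hE1.frame hf2 (by decide)
  have f1 : s2.reg rJ = j := by rw [hf2.reg _ (by decide), hf1.reg _ (by decide), hj]
  have f2 : s2.reg rRow = c * L := by rw [hf2.reg _ (by decide), hf1.reg _ (by decide), hrow]
  have f3 : s2.reg rPA = p + k := by rw [hf2.reg _ (by decide), e1]
  have f4 : s2.reg rPB = e + k := by rw [hf2.reg _ (by decide), e2]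
  have f5 : s2.mem (k * L + L + m) = g m := by rw [i1 _ (by omega), hM.grp m hm]
  have f6 : s2.mem (p + k + m) = s.mem (p + k + m) := i1 _ (by omega)
  have f7 : s2.mem (c * L + m) = a c m := by
    have := mul_add_lt hc hm
    rw [i1 _ (by omega), hM.str c hc m hm]
  refine wp.seq (T₁ := 10) (T₂ := 1) (Q₁ := fun s' => s'.reg rPAj = e + k + m ∧
    s'.reg rV = if g m = j then a c m else s.mem (p + k + m))
    (wp_of_loopFree rfl (by decide) ?_) ?_ le_rfl
  · by_cases h : g m = j
    · simp [Program.run, neq, State.setReg, hrx, f1, f2, f3, f4, f5, f7, hE2.hG, h]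
    · simp [Program.run, neq, State.setReg, hrx, f1, f3, f4, f5, f6, hE2.hG, h, Ne.symm h]
  rintro s3 hf3 ⟨e3, e4⟩
  have hm3 : s3.mem = s2.mem := hf3.mem (by decide)
  refine wp_of_loopFree rfl le_rfl ?_
  simp only [Nat.forall_lt_succ_right]
  simp only [Program.run, State.setMem, Function.update_apply, e3, e4, hm3, if_true]
  refine ⟨fun x hx => ?_, fun i hi => ?_, trivial⟩
  · rw [if_neg (by omega), i1 x hx]
  · rw [if_neg (by omega), i2 i hi]

/-- Clear `R[rOk]` if the budget vector at `R[rEnd]` is already in the list of `R[rNN]` nodes that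
starts at `R[rStart]`. -/
def dedup : Program :=
  .copy rPA rStart ;;
  forLoop rQ rNN rQt (
    .const rEq 1 ;;
    forLoop rI rK rIt (
      .add rPB rPA rI ;; .load rU rPB ;; .add rPB rEnd rI ;; .load rV rPB ;; neq rE rU rV ;;
      .ifPos rE (.const rEq 0) .skip) ;;
    .ifPos rEq (.const rOk 0) .skip ;; .add rPA rPA rZ)

theorem wp_dedup {k L d : ℕ} {s : State} (hE : Env k L d s) {st e nn S : ℕ}
    (hst : s.reg rStart = st) (he : s.reg rEnd = e) (hnn : s.reg rNN = nn) (hS : nn ≤ S) :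
    wp dedup (S * (k * 13 + 11) + 4) (fun s' => 0 < s'.reg rOk ↔ 0 < s.reg rOk ∧
      ∀ q < nn, ¬ ∀ i < k, s.mem (st + q * (k + L) + i) = s.mem (e + i)) s := by
  refine wp.seq (T₁ := 1) (T₂ := S * (k * (9 + 4) + 7 + 4) + 3)
    (Q₁ := fun s' => s'.reg rPA = st)
    (wp_of_loopFree rfl le_rfl ?_) ?_ (by linarith)
  · simp [Program.run, State.setReg, hst]
  rintro s1 hf1 e1
  have hE1 := hE.frame hf1 (by decide)
  have hm1 : s1.mem = s.mem := hf1.mem (by decide)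
  refine wp_for nn (k * (9 + 4) + 7) (fun m s' => s'.reg rPA = st + m * (k + L) ∧
      (0 < s'.reg rOk ↔ 0 < s.reg rOk ∧
        ∀ q < m, ¬ ∀ i < k, s.mem (st + q * (k + L) + i) = s.mem (e + i)))
    ((hf1.reg _ (by decide)).trans hnn) (by decide) (by decide) (fun m s v h => ⟨h, h⟩) ?_ ?_
    (fun s' _ h => h.2) (by gcongr)
  · simp [e1, hf1.reg rOk (by decide)]
  rintro q hq s2 hf2 - ⟨i1, i2⟩
  have hE2 := hE1.frame hf2 (by decide)
  have hm2 : s2.mem = s.mem := (hf2.mem (by decide)).trans hm1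
  have f1 : s2.reg rEnd = e := by rw [hf2.reg _ (by decide), hf1.reg _ (by decide), he]
  refine wp.seq (T₁ := 1) (T₂ := k * (9 + 4) + 6) (Q₁ := fun s' => s'.reg rEq = 1)
    (wp_of_loopFree rfl le_rfl rfl) ?_ (by omega)
  intro s3 hf3 e3
  have hE3 := hE2.frame hf3 (by decide)
  have hm3 : s3.mem = s.mem := (hf3.mem (by decide)).trans hm2
  have g1 : s3.reg rPA = st + q * (k + L) := (hf3.reg _ (by decide)).trans i1
  have g2 : s3.reg rEnd = e := (hf3.reg _ (by decide)).trans f1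
  refine wp.seq (T₁ := k * (9 + 4) + 3) (T₂ := 3) (Q₁ := fun s' => 0 < s'.reg rEq ↔
    ∀ i < k, s.mem (st + q * (k + L) + i) = s.mem (e + i)) ?_ ?_ (by omega)
  · refine wp_for k 9 (fun m s' => 0 < s'.reg rEq ↔
      ∀ i < m, s.mem (st + q * (k + L) + i) = s.mem (e + i))
      hE3.hk (by decide) (by decide) (fun m s v h => ⟨h, h⟩) (by simp [e3]) ?_ (fun s' _ h => h)
      le_rfl
    rintro m hm s4 hf4 hri i3
    have hm4 : s4.mem = s.mem := (hf4.mem (by decide)).trans hm3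
    have h1 : s4.reg rPA = st + q * (k + L) := (hf4.reg _ (by decide)).trans g1
    have h2 : s4.reg rEnd = e := (hf4.reg _ (by decide)).trans g2
    refine wp_of_loopFree rfl (by decide) ?_
    simp only [Nat.forall_lt_succ_right]
    rw [← i3]
    by_cases h : s.mem (st + q * (k + L) + m) = s.mem (e + m)
    · simp [Program.run, neq, State.setReg, hri, h1, h2, hm4, h]
    · simp [Program.run, neq, State.setReg, hri, h1, h2, hm4, h, Ne.symm h]
  · intro s4 hf4 h4
    have hE4 := hE3.frame hf4 (by decide)
    refine wp_of_loopFree rfl (by decide) ?_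
    have h1 : s4.reg rPA = st + q * (k + L) := (hf4.reg _ (by decide)).trans g1
    have h2 : s4.reg rOk = s2.reg rOk := by rw [hf4.reg _ (by decide), hf3.reg _ (by decide)]
    simp only [Nat.forall_lt_succ_right, ← and_assoc, ← i2]
    rw [← h4]
    by_cases h : 0 < s4.reg rEq
    · simp [Program.run, State.setReg, h1, h, hE4.hZ]
      ring
    · simp [Program.run, State.setReg, h1, h2, h, hE4.hZ]
      ring

/-- From address `st` on, the memory contains `n` nodes for the set `D` of groups, with pairwise
different budget vectors. -/
structure NodeList (k L d : ℕ) (a : ℕ → ℕ → ℕ) (w g : ℕ → ℕ) (D : Finset ℕ) (st n : ℕ)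
    (m : ℕ → ℕ) : Prop where
  node : ∀ q < n, Node k L d a w g D (fun i => m (st + q * (k + L) + i))
    (fun x => m (st + q * (k + L) + k + x))
  distinct : ∀ q < n, ∀ q' < q, ¬ ∀ i < k, m (st + q' * (k + L) + i) = m (st + q * (k + L) + i)

/-- There are at most `S` budget vectors of feasible choices on `D`. -/
def CardBound (k L d : ℕ) (a : ℕ → ℕ → ℕ) (w : ℕ → ℕ) (D : Finset ℕ) (S : ℕ) : Prop :=
  ∀ F : Finset (Fin k → ℕ),
    (∀ v ∈ F, ∃ c, Feasible k d a w D c ∧ ∀ i : Fin k, v i = slack L d a w D c i) → #F ≤ S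

/-- This turns the counting of budget vectors into a bound on list length. It applies to every
partially built list, hence also bounds the time of each duplicate search. -/
theorem NodeList.le {k L d S : ℕ} {a : ℕ → ℕ → ℕ} {w g : ℕ → ℕ} {D : Finset ℕ} {st n : ℕ}
    {m : ℕ → ℕ} (h : NodeList k L d a w g D st n m) (hS : CardBound k L d a w D S) : n ≤ S := by
  have hinj : Set.InjOn (fun q => fun i : Fin k => m (st + q * (k + L) + i)) (range n) := by
    intro q hq q' hq' he
    rcases lt_trichotomy q q' with hlt | heq | hlt
    · exact absurd (fun i hi => congrFun he ⟨i, hi⟩) (h.distinct q' (by simpa using hq') q hlt)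
    · exact heq
    · exact absurd (fun i hi => (congrFun he ⟨i, hi⟩).symm)
        (h.distinct q (by simpa using hq) q' hlt)
  rw [← card_range n, ← card_image_of_injOn hinj]
  refine hS _ fun v hv => ?_
  obtain ⟨q, hq, rfl⟩ := mem_image.1 hv
  obtain ⟨c, hc, hcv, -⟩ := h.node q (mem_range.1 hq)
  exact ⟨c, hc, fun i => hcv i i.2⟩

theorem node_add_lt {k L q n x : ℕ} (hq : q < n) (hx : x < k + L) (st : ℕ) :
    st + q * (k + L) + x < st + n * (k + L) := by
  have := mul_add_lt hq hx
  omega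

theorem Node.congr {k L d : ℕ} {a : ℕ → ℕ → ℕ} {w g : ℕ → ℕ} {D : Finset ℕ} {v y v' y' : ℕ → ℕ}
    (h : Node k L d a w g D v y) (hv : ∀ i < k, v' i = v i) (hy : ∀ x < L, y' x = y x) :
    Node k L d a w g D v' y' := by
  obtain ⟨c, h1, h2, h3⟩ := h
  exact ⟨c, h1, fun i hi => (hv i hi).trans (h2 i hi),
    fun x hx hg => (hy x hx).trans (h3 x hx hg)⟩

theorem NodeList.congr {k L d : ℕ} {a : ℕ → ℕ → ℕ} {w g : ℕ → ℕ} {D : Finset ℕ} {st n : ℕ}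
    {m m' : ℕ → ℕ} (h : NodeList k L d a w g D st n m)
    (hm : ∀ x < st + n * (k + L), m' x = m x) : NodeList k L d a w g D st n m' where
  node q hq := (h.node q hq).congr
    (fun i hi => hm _ (node_add_lt hq (by omega) st))
    (fun x hx => by
      have := node_add_lt (k := k) (L := L) hq (x := k + x) (by omega) st
      exact hm _ (by omega))
  distinct q hq q' hq' hc := h.distinct q hq q' hq' fun i hi => by
    rw [← hm _ (node_add_lt hq (by omega) st),
      ← hm _ (node_add_lt (hq'.trans hq) (by omega) st)]
    exact hc i hi

theorem NodeList.succ {k L d : ℕ} {a : ℕ → ℕ → ℕ} {w g : ℕ → ℕ} {D : Finset ℕ} {st n : ℕ}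
    {m : ℕ → ℕ} (h : NodeList k L d a w g D st n m)
    (hn : Node k L d a w g D (fun i => m (st + n * (k + L) + i))
      (fun x => m (st + n * (k + L) + k + x)))
    (hd : ∀ q < n, ¬ ∀ i < k, m (st + q * (k + L) + i) = m (st + n * (k + L) + i)) :
    NodeList k L d a w g D st (n + 1) m where
  node q hq := by
    rcases Nat.lt_succ_iff_lt_or_eq.1 hq with h1 | rfl
    · exact h.node q h1
    · exact hn
  distinct q hq := by
    rcases Nat.lt_succ_iff_lt_or_eq.1 hq with h1 | rfl
    · exact h.distinct q h1
    · exact hd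

/-- The state of the expansion of a list of nodes at `cur` (in the memory `m₀`) by the choices for
the group `j`: the successors of the pairs in `pr` are in the list of `n` nodes at `st`. -/
structure Expanding (k L d : ℕ) (a : ℕ → ℕ → ℕ) (w g : ℕ → ℕ) (D : Finset ℕ) (j cur st : ℕ)
    (m₀ : ℕ → ℕ) (pr : ℕ → ℕ → Prop) (m : ℕ → ℕ) (n : ℕ) : Prop where
  low : ∀ x < st, m x = m₀ x
  list : NodeList k L d a w g (insert j D) st n m
  covered : ∀ q c, pr q c → (∀ i < k, w j * mis a c i j ≤ m₀ (cur + q * (k + L) + i)) →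
    ∃ q' < n, ∀ i < k, m (st + q' * (k + L) + i) =
      min (m₀ (cur + q * (k + L) + i) - w j * mis a c i j) (rest L w D - w j)

theorem Expanding.mono {k L d : ℕ} {a : ℕ → ℕ → ℕ} {w g : ℕ → ℕ} {D : Finset ℕ} {j cur st : ℕ}
    {m₀ : ℕ → ℕ} {pr pr' : ℕ → ℕ → Prop} {m : ℕ → ℕ} {n : ℕ}
    (h : Expanding k L d a w g D j cur st m₀ pr m n) (hp : ∀ q c, pr' q c → pr q c) :
    Expanding k L d a w g D j cur st m₀ pr' m n :=
  ⟨h.low, h.list, fun q c hqc => h.covered q c (hp q c hqc)⟩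

/-- Append the successor of the node at `R[rP]` for the row at the address `R[rRow]` to the new
list, if it is feasible and its budget vector is new. -/
def expand : Program :=
  (.add rPA rRow rJ ;; .load rS rPA ;; .const rOk 1) ;;
  stepVec ;; copyStr ;; dedup ;;
  (.ifPos rOk (.add rEnd rEnd rZ ;; .const rT 1 ;; .add rNN rNN rT) .skip ;; .add rRow rRow rL)

/-- A bound for the running time of `expand`. -/
def expandTime (k L S : ℕ) : ℕ := k * 21 + L * 15 + S * (k * 13 + 11) + 23

/-- The candidate is always written just behind the list; accepting it only means advancing the end,
and a rejected candidate is left outside the list. A feasible candidate is rejected only if its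
vector is already listed, so coverage holds in both cases. -/
theorem wp_expand {k L d S : ℕ} {a : ℕ → ℕ → ℕ} {w g : ℕ → ℕ} {D : Finset ℕ} {j cur st nc q c : ℕ}
    {m₀ : ℕ → ℕ} {pr : ℕ → ℕ → Prop} {s : State} (hE : Env k L d s)
    (hM : Data k L a w g m₀) (hbs : k * L + L + L ≤ st) (hcur : cur + nc * (k + L) ≤ st)
    (hN : NodeList k L d a w g D cur nc m₀) (hjL : j < L) (hjD : j ∉ D)
    (hS : CardBound k L d a w (insert j D) S)
    (hj : s.reg rJ = j) (hwj : s.reg rWJ = w j) (hr : s.reg rR = rest L w D - w j)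
    (hst : s.reg rStart = st) (hq : q < nc) (hp : s.reg rP = cur + q * (k + L)) (hc : c < k)
    (hrow : s.reg rRow = c * L) (hend : s.reg rEnd = st + s.reg rNN * (k + L))
    (hX : Expanding k L d a w g D j cur st m₀ pr s.mem (s.reg rNN)) :
    wp expand (expandTime k L S) (fun s' => s'.reg rRow = (c + 1) * L ∧
      s'.reg rEnd = st + s'.reg rNN * (k + L) ∧
      Expanding k L d a w g D j cur st m₀ (fun q' c' => pr q' c' ∨ (q' = q ∧ c' = c)) s'.mem
        (s'.reg rNN)) s := by
  set n := s.reg rNN with hn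
  set e := st + n * (k + L) with he
  set p := cur + q * (k + L) with hpdef
  -- The parent node lies entirely below the new list, so writing the candidate cannot damage it.
  have hpst : p + k + L ≤ st := by
    have : (q + 1) * (k + L) ≤ nc * (k + L) := Nat.mul_le_mul_right _ hq
    rw [add_mul, one_mul] at this
    omega
  have hste : st ≤ e := Nat.le_add_right _ _
  have hMs : Data k L a w g s.mem :=
    hM.of_eq (fun x hx => hX.low x (by omega)) (fun _ _ => rfl) (fun _ _ => rfl)
  have hnS := hX.list.le hS
  refine wp.seq (T₁ := 3) (T₂ := expandTime k L S - 3)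
    (Q₁ := fun s' => s'.reg rS = a c j ∧ s'.reg rOk = 1) (wp_of_loopFree rfl le_rfl ?_) ?_
    (by unfold expandTime; omega)
  · simp [Program.run, State.setReg, hrow, hj, hMs.str c hc j hjL]
  rintro s1 hf1 ⟨e1, e2⟩
  have hE1 := hE.frame hf1 (by decide)
  have hm1 : s1.mem = s.mem := hf1.mem (by decide)
  refine wp.seq (T₂ := L * 15 + 5 + (S * (k * 13 + 11) + 4 + 5))
    (wp_stepVec hE1 (hm1 ▸ hMs) ((hf1.reg _ (by decide)).trans hj) hjL
    ((hf1.reg _ (by decide)).trans hwj) ((hf1.reg _ (by decide)).trans hp)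
    ((hf1.reg _ (by decide)).trans hend) ((hf1.reg _ (by decide)).trans hr) e1 e2 (by omega)
    (by omega)) ?_ (by unfold expandTime; omega)
  rintro s2 hf2 ⟨i1, i2, i3⟩
  have hE2 := hE1.frame hf2 (by decide)
  rw [hm1] at i1 i2 i3
  have hM2 : Data k L a w g s2.mem :=
    hMs.of_eq (fun x hx => i1 x (by omega)) (fun _ _ => rfl) (fun _ _ => rfl)
  refine wp.seq (T₂ := S * (k * 13 + 11) + 4 + 5) (wp_copyStr hE2 hM2 (c := c) (j := j) (p := p)
    (e := e) ?_ hc ?_ ?_ ?_ (by omega) (by omega)) ?_ le_rfl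
  · rw [hf2.reg _ (by decide), hf1.reg _ (by decide), hj]
  · rw [hf2.reg _ (by decide), hf1.reg _ (by decide), hp]
  · rw [hf2.reg _ (by decide), hf1.reg _ (by decide), hend]
  · rw [hf2.reg _ (by decide), hf1.reg _ (by decide), hrow]
  rintro s3 hf3 ⟨j1, j2⟩
  have hE3 := hE2.frame hf3 (by decide)
  refine wp.seq (T₂ := 5) (wp_dedup hE3 (st := st) (e := e) (nn := n) ?_ ?_ ?_ hnS) ?_ le_rfl
  · rw [hf3.reg _ (by decide), hf2.reg _ (by decide), hf1.reg _ (by decide), hst]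
  · rw [hf3.reg _ (by decide), hf2.reg _ (by decide), hf1.reg _ (by decide), hend]
  · rw [hf3.reg _ (by decide), hf2.reg _ (by decide), hf1.reg _ (by decide)]
  rintro s4 hf4 l1
  have hE4 := hE3.frame hf4 (by decide)
  have hm4 : s4.mem = s3.mem := hf4.mem (by decide)
  rw [hf3.reg rOk (by decide), i2] at l1
  have hlow : ∀ x < e, s4.mem x = s.mem x := fun x hx => by
    rw [hm4, j1 x (by omega), i1 x hx]
  have hvec : ∀ i < k, s4.mem (e + i) =
      min (s.mem (p + i) - w j * mis a c i j) (rest L w D - w j) :=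
    fun i hi => by rw [hm4, j1 _ (by omega), i3 i hi]
  have hstr : ∀ x < L, s4.mem (e + k + x) = if g x = j then a c x else s.mem (p + k + x) :=
    fun x hx => by rw [hm4, j2 x hx, i1 (p + k + x) (by omega)]
  have hpv : ∀ i < k, s.mem (p + i) = m₀ (p + i) := fun i hi => hX.low _ (by omega)
  have hpy : ∀ x < L, s.mem (p + k + x) = m₀ (p + k + x) := fun x hx => hX.low _ (by omega)
  have hlist := hX.list.congr hlow
  have g1 : s4.reg rNN = n := by
    rw [hf4.reg _ (by decide), hf3.reg _ (by decide), hf2.reg _ (by decide),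
      hf1.reg _ (by decide)]
  have g2 : s4.reg rEnd = e := by
    rw [hf4.reg _ (by decide), hf3.reg _ (by decide), hf2.reg _ (by decide),
      hf1.reg _ (by decide), hend]
  have g3 : s4.reg rRow = c * L := by
    rw [hf4.reg _ (by decide), hf3.reg _ (by decide), hf2.reg _ (by decide),
      hf1.reg _ (by decide), hrow]
  have hlow' : ∀ x < st, s4.mem x = m₀ x := fun x hx => by
    rw [hlow x (by omega), hX.low x hx]
  have hcov : ∀ q' < n, ∀ i < k, s4.mem (st + q' * (k + L) + i) = s.mem (st + q' * (k + L) + i) :=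
    fun q' hq' i hi => hlow _ (node_add_lt hq' (by omega) st)
  by_cases hok : 0 < s4.reg rOk
  · obtain ⟨h1, h2⟩ := l1.1 hok
    have hv : ∀ i < k, s4.mem (e + i) =
        min (m₀ (p + i) - w j * mis a c i j) (rest L w D - w j) := fun i hi => by
      rw [hvec i hi, hpv i hi]
    have hnode : Node k L d a w g (insert j D) (fun i => s4.mem (e + i))
        (fun x => s4.mem (e + k + x)) :=
      (hN.node q hq).step hjL hjD hc (fun i hi => by rw [← hpv i hi]; exact h1 i hi) hv
        fun x hx => by rw [hstr x hx, hpy x hx]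
    have hnew : Expanding k L d a w g D j cur st m₀ (fun q' c' => pr q' c' ∨ (q' = q ∧ c' = c))
        s4.mem (n + 1) := by
      refine ⟨hlow', hlist.succ hnode (by rw [hm4]; exact h2), ?_⟩
      rintro q' c' (hpr | ⟨rfl, rfl⟩) hf
      · obtain ⟨q'', hq'', hv''⟩ := hX.covered q' c' hpr hf
        exact ⟨q'', by omega, fun i hi => by rw [hcov q'' hq'' i hi, hv'' i hi]⟩
      · exact ⟨n, by omega, hv⟩
    refine wp_of_loopFree rfl le_rfl ?_
    have hmem : (Program.run (.ifPos rOk (.add rEnd rEnd rZ ;; .const rT 1 ;; .add rNN rNN rT)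
        .skip ;; .add rRow rRow rL) s4).mem = s4.mem := by
      simp [Program.run, State.setReg, hok]
    have hnn : (Program.run (.ifPos rOk (.add rEnd rEnd rZ ;; .const rT 1 ;; .add rNN rNN rT)
        .skip ;; .add rRow rRow rL) s4).reg rNN = n + 1 := by
      simp [Program.run, State.setReg, hok, g1]
    rw [hmem, hnn]
    refine ⟨?_, ?_, hnew⟩
    · simp [Program.run, State.setReg, hok, g3, hE4.hL, Nat.succ_mul]
    · simp [Program.run, State.setReg, hok, g2, hE4.hZ, he]
      ring
  · have hnew : Expanding k L d a w g D j cur st m₀ (fun q' c' => pr q' c' ∨ (q' = q ∧ c' = c))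
        s4.mem n := by
      refine ⟨hlow', hlist, ?_⟩
      rintro q' c' (hpr | ⟨rfl, rfl⟩) hf
      · obtain ⟨q'', hq'', hv''⟩ := hX.covered q' c' hpr hf
        exact ⟨q'', hq'', fun i hi => by rw [hcov q'' hq'' i hi, hv'' i hi]⟩
      · have h1 : ∀ i < k, w j * mis a c' i j ≤ s.mem (p + i) := fun i hi => by
          rw [hpv i hi]; exact hf i hi
        -- The pair is feasible but was rejected, so the duplicate search must have found its
        -- vector.
        have h2 : ∃ q' < n, ∀ i < k, s3.mem (st + q' * (k + L) + i) = s3.mem (e + i) := by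
          by_contra hcon
          push Not at hcon
          refine hok (l1.2 ⟨h1, fun q' hq' hall => ?_⟩)
          obtain ⟨i, hi, hne⟩ := hcon q' hq'
          exact hne (hall i hi)
        obtain ⟨q'', hq'', hv''⟩ := h2
        refine ⟨q'', hq'', fun i hi => ?_⟩
        rw [hm4, hv'' i hi, ← hm4, hvec i hi, hpv i hi]
    refine wp_of_loopFree rfl le_rfl ?_
    have hmem : (Program.run (.ifPos rOk (.add rEnd rEnd rZ ;; .const rT 1 ;; .add rNN rNN rT)
        .skip ;; .add rRow rRow rL) s4).mem = s4.mem := by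
      simp [Program.run, State.setReg, hok]
    have hnn : (Program.run (.ifPos rOk (.add rEnd rEnd rZ ;; .const rT 1 ;; .add rNN rNN rT)
        .skip ;; .add rRow rRow rL) s4).reg rNN = n := by
      simp [Program.run, State.setReg, hok, g1]
    rw [hmem, hnn]
    refine ⟨?_, ?_, hnew⟩
    · simp [Program.run, State.setReg, hok, g3, hE4.hL, Nat.succ_mul]
    · simp [Program.run, State.setReg, hok, g2, he]

/-- The list of `n` nodes at `cur` represents all feasible choices for the set `D` of groups. -/
structure Layer (k L d : ℕ) (a : ℕ → ℕ → ℕ) (w g : ℕ → ℕ) (S : ℕ) (D : Finset ℕ) (m : ℕ → ℕ)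
    (r cur n e : ℕ) : Prop where
  data : Data k L a w g m
  list : NodeList k L d a w g D cur n m
  complete : ∀ c, Feasible k d a w D c →
    ∃ q < n, ∀ i < k, m (cur + q * (k + L) + i) = slack L d a w D c i
  card_le : n ≤ S
  rest_eq : r = rest L w D
  base_le : k * L + L + L ≤ cur
  end_eq : e = cur + n * (k + L)

/-- Extend the choices of the current layer to the group `R[rJ]` of weight `R[rWJ]`. -/
def layer : Program :=
  (.sub rR rR rWJ ;; .copy rStart rEnd ;; .copy rP rCur ;; .const rNN 0) ;;
  forLoop rH rNC rHt (.const rRow 0 ;; forLoop rC rK rCt expand ;; .add rP rP rZ) ;;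
  (.copy rCur rStart ;; .copy rNC rNN)

/-- A bound for the running time of `layer`. -/
def layerTime (k L S : ℕ) : ℕ := S * (k * (expandTime k L S + 4) + 9) + 9

theorem wp_layer {k L d S : ℕ} {a : ℕ → ℕ → ℕ} {w g : ℕ → ℕ} {D : Finset ℕ} {j : ℕ} {s : State}
    (hE : Env k L d s) (hj : s.reg rJ = j) (hjL : j < L) (hjD : j ∉ D) (hwj : s.reg rWJ = w j)
    (hS : CardBound k L d a w (insert j D) S)
    (hI : Layer k L d a w g S D s.mem (s.reg rR) (s.reg rCur) (s.reg rNC) (s.reg rEnd)) :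
    wp layer (layerTime k L S) (fun s' => Layer k L d a w g S (insert j D) s'.mem (s'.reg rR)
      (s'.reg rCur) (s'.reg rNC) (s'.reg rEnd)) s := by
  set m₀ := s.mem with hm₀
  set cur := s.reg rCur with hcur
  set nc := s.reg rNC with hnc
  set st := s.reg rEnd with hst
  have hend : st = cur + nc * (k + L) := hI.end_eq
  have hcs : cur ≤ st := by omega
  have hbase := hI.base_le
  refine wp.seq (T₁ := 4) (T₂ := S * (k * (expandTime k L S + 4) + 5 + 4) + 3 + 2)
    (Q₁ := fun s' => s'.reg rR = rest L w D - w j ∧ s'.reg rStart = st ∧ s'.reg rP = cur ∧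
      s'.reg rNN = 0) (wp_of_loopFree rfl le_rfl ?_) ?_ (by unfold layerTime; linarith)
  · simp [Program.run, State.setReg, hI.rest_eq, hwj, ← hcur, ← hst]
  rintro s1 hf1 ⟨e1, e2, e3, e4⟩
  have hE1 := hE.frame hf1 (by decide)
  have hm1 : s1.mem = m₀ := hf1.mem (by decide)
  have hX0 : Expanding k L d a w g D j cur st m₀ (fun _ _ => False) s1.mem 0 :=
    ⟨fun _ _ => by rw [hm1], ⟨fun q hq => absurd hq (by omega), fun q hq => absurd hq (by omega)⟩,
      fun _ _ h => h.elim⟩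
  refine wp.seq (T₁ := S * (k * (expandTime k L S + 4) + 5 + 4) + 3) (T₂ := 2) (Q₁ := fun s' =>
    s'.reg rEnd = st + s'.reg rNN * (k + L) ∧
    Expanding k L d a w g D j cur st m₀ (fun q c => q < nc ∧ c < k) s'.mem (s'.reg rNN)) ?_ ?_
    le_rfl
  · refine wp_for nc (k * (expandTime k L S + 4) + 5) (fun q s' => s'.reg rP = cur + q * (k + L) ∧
      s'.reg rEnd = st + s'.reg rNN * (k + L) ∧
      Expanding k L d a w g D j cur st m₀ (fun q' c => q' < q ∧ c < k) s'.mem (s'.reg rNN))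
      (hf1.reg _ (by decide)) (by decide) (by decide) (fun m s v h => ⟨h, h⟩) ?_ ?_
      (fun s' _ h => h.2) (Nat.add_le_add_right (Nat.mul_le_mul_right _ hI.card_le) _)
    · refine ⟨by simp [e3], by simp [e4, hf1.reg rEnd (by decide), ← hst], ?_⟩
      rw [e4]
      exact hX0.mono fun q c h => by omega
    rintro q hq s2 hf2 - ⟨i1, i2, i3⟩
    have hE2 := hE1.frame hf2 (by decide)
    refine wp.seq (T₁ := 1) (T₂ := k * (expandTime k L S + 4) + 4) (Q₁ := fun s' => s'.reg rRow = 0)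
      (wp_of_loopFree rfl le_rfl rfl) ?_ (by omega)
    intro s3 hf3 e5
    have hE3 := hE2.frame hf3 (by decide)
    refine wp.seq (T₁ := k * (expandTime k L S + 4) + 3) (T₂ := 1) (Q₁ := fun s' =>
      s'.reg rEnd = st + s'.reg rNN * (k + L) ∧ Expanding k L d a w g D j cur st m₀
        (fun q' c' => (q' < q ∧ c' < k) ∨ (q' = q ∧ c' < k)) s'.mem (s'.reg rNN)) ?_ ?_ le_rfl
    · refine wp_for k (expandTime k L S) (fun c s' => s'.reg rRow = c * L ∧
        s'.reg rEnd = st + s'.reg rNN * (k + L) ∧ Expanding k L d a w g D j cur st m₀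
          (fun q' c' => (q' < q ∧ c' < k) ∨ (q' = q ∧ c' < c)) s'.mem (s'.reg rNN))
        hE3.hk (by decide) (by decide) (fun m s v h => ⟨h, h⟩) ?_ ?_ (fun s' _ h => h.2) le_rfl
      · refine ⟨by simp [e5], ?_, ?_⟩
        · rw [hf3.reg _ (by decide), hf3.reg rNN (by decide), i2]
        · rw [hf3.mem (by decide), hf3.reg rNN (by decide)]
          exact i3.mono fun q c h => by omega
      rintro c hc s4 hf4 - ⟨j1, j2, j3⟩
      have hE4 := hE3.frame hf4 (by decide)
      refine wp.mono (wp_expand (c := c) (q := q) (nc := nc) hE4 hI.data (by omega) (by omega)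
        hI.list hjL hjD hS ?_ ?_ ?_ ?_ hq ?_ hc j1 j2 j3) le_rfl ?_
      · rw [hf4.reg _ (by decide), hf3.reg _ (by decide), hf2.reg _ (by decide),
          hf1.reg _ (by decide), hj]
      · rw [hf4.reg _ (by decide), hf3.reg _ (by decide), hf2.reg _ (by decide),
          hf1.reg _ (by decide), hwj]
      · rw [hf4.reg _ (by decide), hf3.reg _ (by decide), hf2.reg _ (by decide), e1]
      · rw [hf4.reg _ (by decide), hf3.reg _ (by decide), hf2.reg _ (by decide), e2]
      · rw [hf4.reg _ (by decide), hf3.reg _ (by decide), i1]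
      · rintro s5 - ⟨k1, k2, k3⟩
        exact ⟨k1, k2, k3.mono fun q c h => by omega⟩
    · rintro s4 hf4 ⟨k1, k2⟩
      have hE4 := hE3.frame hf4 (by decide)
      refine wp_of_loopFree rfl le_rfl ?_
      have hP : s4.reg rP = cur + q * (k + L) := by
        rw [hf4.reg _ (by decide), hf3.reg _ (by decide), i1]
      refine ⟨?_, k1, k2.mono fun q c h => by omega⟩
      simp [Program.run, State.setReg, hP, hE4.hZ]
      ring
  · rintro s2 hf2 ⟨i1, i2⟩
    refine wp_of_loopFree rfl le_rfl ?_
    have g1 : s2.reg rStart = st := by rw [hf2.reg _ (by decide), e2]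
    have g2 : s2.reg rR = rest L w D - w j := by rw [hf2.reg _ (by decide), e1]
    show Layer k L d a w g S (insert j D) s2.mem (s2.reg rR) (s2.reg rStart) (s2.reg rNN)
      (s2.reg rEnd)
    rw [g1, g2]
    refine ⟨hI.data.of_eq (fun x hx => i2.low x (by omega)) (fun _ _ => rfl) (fun _ _ => rfl),
      i2.list, fun c hc => ?_, i2.list.le hS, ?_, by omega, i1⟩
    -- Completeness carries over: restrict the choice to `D`, find its vector in the old layer, and
    -- follow the row chosen for `j`. The stored node may come from another choice, but only its
    -- vector matters.
    · obtain ⟨h1, h2⟩ := hc.slack_insert hjL hjD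
      obtain ⟨q, hq, hqv⟩ := hI.complete c h1
      obtain ⟨q', hq', hv⟩ := i2.covered q (c j) ⟨hq, hc.1 j⟩ fun i hi => by
        rw [hqv i hi]; exact (h2 i hi).1
      exact ⟨q', hq', fun i hi => by rw [hv i hi, hqv i hi, (h2 i hi).2]⟩
    · rw [rest_insert hjL hjD]; omega

/-! ### Layers in order of decreasing weight -/

/-- Process the groups in the order of decreasing weight. -/
def allLayers : Program :=
  forLoop rM rL rMt (
    .sub rWW rL rM ;;
    forLoop rJ rL rJt (
      (.add rPA rW rJ ;; .load rWJ rPA ;; neq rE rWJ rWW) ;;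
      .ifPos rE .skip layer))

/-- The groups of weight more than `W`, and those of weight `W` with a number less than `x`. -/
def processed (L : ℕ) (w : ℕ → ℕ) (W x : ℕ) : Finset ℕ :=
  {j ∈ range L | W < w j ∨ (w j = W ∧ j < x)}

/-- No sorting is needed: every number from `L` down to 1 is tried as a weight, with a scan over all
groups for each. Bounds on the number of vectors are required only at the prefixes of this order. -/
theorem wp_allLayers {k L d S : ℕ} {a : ℕ → ℕ → ℕ} {w g : ℕ → ℕ} {s : State}
    (hE : Env k L d s)
    (hS : ∀ j < L, w j ≠ 0 → CardBound k L d a w (processed L w (w j) (j + 1)) S)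
    (hI : Layer k L d a w g S (processed L w L 0) s.mem (s.reg rR) (s.reg rCur) (s.reg rNC)
      (s.reg rEnd)) :
    wp allLayers (L * (L * (layerTime k L S + 10) + 8) + 3) (fun s' =>
      Layer k L d a w g S (processed L w 0 0) s'.mem (s'.reg rR) (s'.reg rCur) (s'.reg rNC)
        (s'.reg rEnd)) s := by
  refine wp_for L (L * (layerTime k L S + 10) + 4) (fun m s' =>
    Layer k L d a w g S (processed L w (L - m) 0) s'.mem (s'.reg rR) (s'.reg rCur) (s'.reg rNC)
      (s'.reg rEnd)) hE.hL (by decide) (by decide) (fun m s v h => ⟨h, h⟩) hI ?_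
    (fun s' _ h => by simpa using h) le_rfl
  rintro m hm s1 hf1 hrm hI1
  have hE1 := hE.frame hf1 (by decide)
  refine wp.seq (T₁ := 1) (T₂ := L * (layerTime k L S + 6 + 4) + 3)
    (Q₁ := fun s' => s'.reg rWW = L - m) (wp_of_loopFree rfl le_rfl ?_) ?_ (by linarith)
  · simp [Program.run, State.setReg, hE1.hL, hrm]
  intro s2 hf2 e2
  have hE2 := hE1.frame hf2 (by decide)
  refine wp_for L (layerTime k L S + 6) (fun x s' =>
    Layer k L d a w g S (processed L w (L - m) x) s'.mem (s'.reg rR) (s'.reg rCur) (s'.reg rNC)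
      (s'.reg rEnd)) hE2.hL (by decide) (by decide) (fun m s v h => ⟨h, h⟩) ?_ ?_ ?_ le_rfl
  · rw [hf2.mem (by decide), hf2.reg rR (by decide), hf2.reg rCur (by decide),
      hf2.reg rNC (by decide), hf2.reg rEnd (by decide)]
    exact hI1
  · rintro j hj s3 hf3 hrj hI3
    have hE3 := hE2.frame hf3 (by decide)
    have hrw : s3.reg rWW = L - m := (hf3.reg _ (by decide)).trans e2
    refine wp.seq (T₁ := 5) (T₂ := layerTime k L S + 1) (Q₁ := fun s' => s'.reg rWJ = w j ∧
      (0 < s'.reg rE ↔ w j ≠ L - m)) (wp_of_loopFree rfl le_rfl ?_) ?_ (by omega)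
    · simp only [Program.run, neq, State.setReg, Function.update_apply, hrj, hE3.hW,
        hI3.data.wt j hj, hrw, Nat.reduceEqDiff, if_true, if_false, pos_sub_add_sub_iff, true_and]
    rintro s4 hf4 ⟨e3, e4⟩
    have hE4 := hE3.frame hf4 (by decide)
    rw [← hf4.mem (by decide), ← hf4.reg rR (by decide), ← hf4.reg rCur (by decide),
      ← hf4.reg rNC (by decide), ← hf4.reg rEnd (by decide)] at hI3
    refine wp.ifPos (T := layerTime k L S) (fun h => ?_) (fun h => ?_) le_rfl
    · refine wp_of_loopFree rfl (by unfold layerTime; simp [Program.cost]) ?_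
      have : processed L w (L - m) (j + 1) = processed L w (L - m) j := by
        have hne := e4.1 h
        ext x
        simp only [processed, mem_filter, mem_range]
        grind
      rw [this]
      exact hI3
    · have hw : w j = L - m := by by_contra hc; have := e4.2 hc; omega
      have : processed L w (L - m) (j + 1) = insert j (processed L w (L - m) j) := by
        ext x
        simp only [processed, mem_filter, mem_range, mem_insert]
        grind
      -- The current weight `L - m` is positive because `m < L`, so emptied groups are never
      -- treated.
      have hSj := hS j hj (by omega)
      rw [hw] at hSj
      rw [this] at hSj ⊢
      refine wp_layer hE4 ((hf4.reg _ (by decide)).trans hrj) hj ?_ e3 hSj hI3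
      simp [processed, hw]
  · intro s' _ h
    have : processed L w (L - (m + 1)) 0 = processed L w (L - m) L := by
      ext x
      simp only [processed, mem_filter, mem_range]
      grind
    rwa [this]

/-! ### Initialization and output -/

/-- Compute the base addresses and write the initial weights and group names. -/
def initData : Program :=
  .const rW 0 ;;
  forLoop rI rK rIt (.add rW rW rL) ;;
  (.add rG rW rL ;; .add rZ rK rL) ;;
  forLoop rX rL rXt
    (.add rPA rW rX ;; .const rV 1 ;; .store rPA rV ;; .add rPA rG rX ;; .store rPA rX)

theorem wp_initData {k L d : ℕ} {a : ℕ → ℕ → ℕ} {s : State} (hk : s.reg rK = k)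
    (hL : s.reg rL = L) (hd : s.reg rD = d) (ha : ∀ i < k, ∀ x < L, s.mem (i * L + x) = a i x) :
    wp initData (k * 5 + L * 9 + 9) (fun s' => Env k L d s' ∧ ∃ w g : ℕ → ℕ,
      (∀ x < L, w x = 1 ∧ g x = x) ∧ Data k L a w g s'.mem) s := by
  refine wp.seq (T₁ := 1) (T₂ := k * (1 + 4) + 3 + (2 + (L * 9 + 3)))
    (Q₁ := fun s' => s'.reg rW = 0) (wp_of_loopFree rfl le_rfl rfl) ?_ (by omega)
  intro s1 hf1 e1
  refine wp.seq (T₁ := k * (1 + 4) + 3) (T₂ := 2 + (L * 9 + 3)) (Q₁ := fun s' => s'.reg rW = k * L)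
    ?_ ?_ le_rfl
  · refine wp_for k 1 (fun m s' => s'.reg rW = m * L) ((hf1.reg _ (by decide)).trans hk)
      (by decide) (by decide) (fun m s v h => ⟨h, h⟩) (by simp [e1]) ?_ (fun s' _ h => h) le_rfl
    intro m hm s2 hf2 _ h
    refine wp_of_loopFree rfl le_rfl ?_
    have : s2.reg rL = L := by rw [hf2.reg _ (by decide), hf1.reg _ (by decide), hL]
    simp [Program.run, State.setReg, h, this, Nat.succ_mul]
  intro s2 hf2 e2
  have g1 : s2.reg rK = k := by rw [hf2.reg _ (by decide), hf1.reg _ (by decide), hk]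
  have g2 : s2.reg rL = L := by rw [hf2.reg _ (by decide), hf1.reg _ (by decide), hL]
  have g3 : s2.reg rD = d := by rw [hf2.reg _ (by decide), hf1.reg _ (by decide), hd]
  have hm2 : s2.mem = s.mem := (hf2.mem (by decide)).trans (hf1.mem (by decide))
  refine wp.seq (T₁ := 2) (T₂ := L * (5 + 4) + 3) (Q₁ := fun s' => Env k L d s')
    (wp_of_loopFree rfl le_rfl ?_) ?_ le_rfl
  · constructor <;> simp [Program.run, State.setReg, g1, g2, g3, e2]
  intro s3 hf3 hE3
  have hm3 : s3.mem = s.mem := (hf3.mem (by decide)).trans hm2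
  refine wp_for L 5 (fun m s' => ∃ w g : ℕ → ℕ,
    (∀ x < m, w x = 1 ∧ g x = x) ∧ Data k L a w g s'.mem)
    hE3.hL (by decide) (by decide) (fun m s v h => ⟨h, h⟩) ?_ ?_
    (fun s' hf h => ⟨hE3.frame hf (by decide), h⟩) le_rfl
  · exact ⟨fun x => s.mem (k * L + x), fun x => s.mem (k * L + L + x),
      fun x hx => absurd hx (by omega), ⟨by rwa [hm3], by simp [hm3], by simp [hm3]⟩⟩
  rintro x hx s4 hf4 hrx ⟨w, g, h1, h2⟩
  have hE4 := hE3.frame hf4 (by decide)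
  refine wp_of_loopFree rfl le_rfl
    ⟨Function.update w x 1, Function.update g x x, fun y hy => ?_, ?_⟩
  · rcases Nat.lt_succ_iff_lt_or_eq.1 hy with h3 | rfl
    · rw [Function.update_of_ne h3.ne, Function.update_of_ne h3.ne]
      exact h1 y h3
    · simp
  · have := (h2.store_wt hx 1).store_grp hx x
    simpa [Program.run, State.setReg, State.setMem, hrx, hE4.hW, hE4.hG] using this

/-- Write the root node. -/
def initLayer : Program :=
  (.add rCur rG rL ;; .sub rT rD rL ;; .sub rV rD rT) ;;
  forLoop rI rK rIt (.add rPA rCur rI ;; .store rPA rV) ;;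
  (.add rEnd rCur rZ ;; .const rNC 1 ;; .copy rR rL)

theorem wp_initLayer {k L d S : ℕ} {a : ℕ → ℕ → ℕ} {w g : ℕ → ℕ} {s : State} (hE : Env k L d s)
    (hM : Data k L a w g s.mem) (hG : Grouping k L d a w g) (hk : 0 < k) (hS : 1 ≤ S) :
    wp initLayer (k * 6 + 9) (fun s' => Layer k L d a w g S (processed L w L 0) s'.mem (s'.reg rR)
      (s'.reg rCur) (s'.reg rNC) (s'.reg rEnd)) s := by
  have hD : processed L w L 0 = ∅ := by
    rw [processed, filter_eq_empty_iff]
    intro x hx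
    have : w x ≤ L := by
      rw [hG.w_eq x (mem_range.1 hx)]
      exact (card_filter_le _ _).trans (by simp)
    omega
  have hR : rest L w ∅ = L := by
    rw [rest, sdiff_empty, sum_congr rfl fun j hj => hG.w_eq j (mem_range.1 hj),
      ← card_eq_sum_card_fiberwise fun x hx => by
        simpa using hG.g_lt x (by simpa using hx), card_range]
  -- Before any choice the load is zero and the remaining weight is the number of columns, so all
  -- entries of the root vector are equal.
  have hsl : ∀ c i, slack L d a w ∅ c i = min d L := fun c i => by simp [slack, load, hR]
  rw [hD]
  set B := k * L + L + L with hB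
  refine wp.seq (T₁ := 3) (T₂ := k * (2 + 4) + 3 + 3) (Q₁ := fun s' => s'.reg rCur = B ∧
    s'.reg rV = min d L) (wp_of_loopFree rfl le_rfl ?_) ?_ (by omega)
  · simp [Program.run, State.setReg, hE.hG, hE.hL, hE.hd, hB]
    omega
  rintro s1 hf1 ⟨e1, e2⟩
  have hE1 := hE.frame hf1 (by decide)
  have hm1 : s1.mem = s.mem := hf1.mem (by decide)
  refine wp.seq (T₁ := k * (2 + 4) + 3) (T₂ := 3) (Q₁ := fun s' =>
    (∀ x < B, s'.mem x = s.mem x) ∧ ∀ i < k, s'.mem (B + i) = min d L) ?_ ?_ le_rfl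
  · refine wp_for k 2 (fun m s' => (∀ x < B, s'.mem x = s.mem x) ∧
      ∀ i < m, s'.mem (B + i) = min d L) hE1.hk (by decide) (by decide) (fun m s v h => ⟨h, h⟩)
      (by simp [hm1]) ?_ (fun s' _ h => h) le_rfl
    rintro m hm s2 hf2 hri ⟨i1, i2⟩
    have f1 : s2.reg rCur = B := (hf2.reg _ (by decide)).trans e1
    have f2 : s2.reg rV = min d L := (hf2.reg _ (by decide)).trans e2
    refine wp_of_loopFree rfl le_rfl ?_
    simp only [Nat.forall_lt_succ_right]
    simp only [Program.run, State.setReg, State.setMem, Function.update_apply, f1, f2, hri,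
      Nat.reduceEqDiff, if_true, if_false]
    refine ⟨fun x hx => ?_, fun i hi => ?_, trivial⟩
    · rw [if_neg (by omega), i1 x hx]
    · rw [if_neg (by omega), i2 i hi]
  rintro s2 hf2 ⟨i1, i2⟩
  have hE2 := hE1.frame hf2 (by decide)
  have f1 : s2.reg rCur = B := (hf2.reg _ (by decide)).trans e1
  refine wp_of_loopFree rfl le_rfl ?_
  simp only [Program.run, State.setReg, Function.update_apply, f1, hE2.hZ, hE2.hL,
    Nat.reduceEqDiff, if_true, if_false]
  refine ⟨hM.of_eq i1 (fun _ _ => rfl) (fun _ _ => rfl), ⟨fun q hq => ?_, fun q hq q' hq' => ?_⟩,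
    fun c _ => ⟨0, by omega, fun i hi => ?_⟩, hS, hR.symm, le_rfl, by ring⟩
  · obtain rfl : q = 0 := by omega
    refine ⟨fun _ => 0, ⟨fun _ => hk, fun i hi => by simp [load]⟩, fun i hi => ?_,
      fun x hx h => absurd h (by simp)⟩
    simp only [hsl, zero_mul, add_zero, i2 i hi]
  · omega
  · rw [hsl, zero_mul, add_zero, i2 i hi]

/-- Write the string of the first node of the last layer, if there is one. -/
def output : Program :=
  .ifPos rNC
    (.add rPA rCur rK ;;
      forLoop rX rL rXt (.add rPB rPA rX ;; .load rV rPB ;; .store rX rV) ;; .const rK 1)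
    (.const rK 0)

theorem wp_output {k L d : ℕ} {s : State} (hE : Env k L d s) {cur n : ℕ}
    (hc : s.reg rCur = cur) (hn : s.reg rNC = n) (hL : L ≤ cur) :
    wp output (L * 7 + 6) (fun s' => (0 < n ∧ s'.reg rK = 1 ∧
      ∀ x < L, s'.mem x = s.mem (cur + k + x)) ∨ (n = 0 ∧ s'.reg rK = 0)) s := by
  refine wp.ifPos (T := L * 7 + 5) (fun h => ?_) (fun h => ?_) le_rfl
  · refine wp.seq (T₁ := 1) (T₂ := L * (3 + 4) + 4) (Q₁ := fun s' => s'.reg rPA = cur + k)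
      (wp_of_loopFree rfl le_rfl ?_) ?_ (by omega)
    · simp [Program.run, State.setReg, hc, hE.hk]
    intro s1 hf1 e1
    have hE1 := hE.frame hf1 (by decide)
    have hm1 : s1.mem = s.mem := hf1.mem (by decide)
    refine wp.seq (T₁ := L * (3 + 4) + 3) (T₂ := 1) (Q₁ := fun s' =>
      ∀ x < L, s'.mem x = s.mem (cur + k + x)) ?_ ?_ le_rfl
    -- The string is copied over the first `L` cells, and its source lies at or beyond address `L`,
    -- so it is never overwritten before it is read.
    · refine wp_for L 3 (fun m s' => (∀ x, L ≤ x → s'.mem x = s.mem x) ∧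
        ∀ x < m, s'.mem x = s.mem (cur + k + x)) hE1.hL (by decide) (by decide)
        (fun m s v h => ⟨h, h⟩) (by simp [hm1]) ?_ (fun s' _ h => h.2) le_rfl
      rintro m hm s2 hf2 hrx ⟨i1, i2⟩
      have f1 : s2.reg rPA = cur + k := (hf2.reg _ (by decide)).trans e1
      have f2 := i1 (cur + k + m) (by omega)
      refine wp_of_loopFree rfl le_rfl ?_
      simp only [Nat.forall_lt_succ_right]
      simp only [Program.run, State.setReg, State.setMem, Function.update_apply, f1, f2, hrx,
        Nat.reduceEqDiff, if_true, if_false]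
      refine ⟨fun x hx => ?_, fun x hx => ?_, trivial⟩
      · rw [if_neg (by omega), i1 x hx]
      · rw [if_neg (by omega), i2 x hx]
    · intro s2 hf2 h2
      exact wp_of_loopFree rfl le_rfl (.inl ⟨hn ▸ h, rfl, h2⟩)
  · exact wp_of_loopFree rfl (by simp [Program.cost]) (.inr ⟨hn ▸ h, rfl⟩)

/-! ### The complete program and its correctness -/

/-- The program for Closest String. -/
def program : Program := initData ;; mergeAll ;; initLayer ;; allLayers ;; output

/-- A bound for the running time of `program`, if there are at most `S` nodes in every layer. -/
def programTime (k L S : ℕ) : ℕ :=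
  k * 5 + L * 9 + 9 + (((L * (L + 1) + L) * (mergeTime k L + 1) + 3) + (k * 6 + 9 +
    (L * (L * (layerTime k L S + 10) + 8) + 3 + (L * 7 + 6))))

/-- The order by weight supplies both hypotheses of the count: with `w j = 2 ^ e`, treated weights
are powers of two at least `2 ^ e`, hence multiples of it, and all others are at most `2 ^ e`. It
holds in the middle of a weight class too. -/
theorem cardBound_processed {k L d : ℕ} {a : ℕ → ℕ → ℕ} {w g : ℕ → ℕ} (hG : Grouping k L d a w g)
    (hR : Reduced k a w L) {α : Type*} [Fintype α] [DecidableEq α] (ty : ℕ → α)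
    (hty : ∀ x < L, ∀ y < L, ty x = ty y → SameType k a x y) {j : ℕ} (hj : j < L) (hj0 : w j ≠ 0) :
    CardBound k L d a w (processed L w (w j) (j + 1)) ((2 * k * Fintype.card α + 2) ^ k) := by
  obtain ⟨e, he⟩ := hG.pow j hj hj0
  refine fun F hF => card_le_of_slack (e := e) (rest_le ty hty hG.pow hR fun x hx hxD => ?_)
    (fun x hx => ?_) F hF
  · simp only [processed, mem_filter, mem_range, hx, true_and, not_or, not_lt] at hxD
    exact he ▸ hxD.1
  · simp only [processed, mem_filter, mem_range] at hx
    have h1 : 2 ^ e ≤ w x := by omega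
    obtain ⟨u, hu⟩ := hG.pow x hx.1 (by omega)
    rw [hu] at h1 ⊢
    exact pow_dvd_pow 2 ((Nat.pow_le_pow_iff_right (by norm_num)).1 h1)

/-- A node in the last layer gives a solution by `Node.solution`. Conversely, a solution gives a
uniform choice by `Grouping.complete`, whose vector must then be in the last layer. -/
theorem wp_program {k L d S : ℕ} {a : ℕ → ℕ → ℕ} {s : State} {α : Type*} [Fintype α]
    [DecidableEq α] (ty : ℕ → α) (hty : ∀ x < L, ∀ y < L, ty x = ty y → SameType k a x y)
    (hS : S = (2 * k * Fintype.card α + 2) ^ k) (hk0 : 0 < k) (hk : s.reg rK = k)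
    (hL : s.reg rL = L) (hd : s.reg rD = d) (ha : ∀ i < k, ∀ x < L, s.mem (i * L + x) = a i x) :
    wp program (programTime k L S) (fun s' =>
      (s'.reg rK = 1 ∧ ∃ y : ℕ → ℕ, (∀ i < k, #{x ∈ range L | y x ≠ a i x} ≤ d) ∧
        (∀ x < L, ∃ c < k, y x = a c x) ∧ ∀ x < L, s'.mem x = y x) ∨
      (s'.reg rK = 0 ∧ ¬ ∃ y : ℕ → ℕ, ∀ i < k, #{x ∈ range L | y x ≠ a i x} ≤ d)) s := by
  refine wp.seq (wp_initData hk hL hd ha) ?_ le_rfl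
  rintro s1 - ⟨hE1, w, g, hwg, hM1⟩
  refine wp.seq (wp_mergeAll hE1 hM1 (.init hk0 (fun x hx => (hwg x hx).1)
    (fun x hx => (hwg x hx).2)) hk0) ?_ le_rfl
  rintro s2 hf2 ⟨w, g, hM2, hG, hR⟩
  have hE2 := hE1.frame hf2 (by decide)
  refine wp.seq (wp_initLayer hE2 hM2 hG hk0 (S := S)
    (by rw [hS]; exact Nat.one_le_pow _ _ (by omega))) ?_ le_rfl
  intro s3 hf3 hI3
  have hE3 := hE2.frame hf3 (by decide)
  refine wp.seq (wp_allLayers hE3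
    (fun j hj hj0 => hS ▸ cardBound_processed hG hR ty hty hj hj0) hI3) ?_ le_rfl
  intro s4 hf4 hI4
  have hE4 := hE3.frame hf4 (by decide)
  have hDL : processed L w 0 0 ⊆ range L := filter_subset _ _
  refine wp.mono (wp_output hE4 rfl rfl (by have := hI4.base_le; omega)) le_rfl ?_
  rintro s5 - (⟨hn, h1, h2⟩ | ⟨hn, h1⟩)
  · left
    refine ⟨h1, fun x => s4.mem (s4.reg rCur + k + x), ?_⟩
    have h3 := (hI4.list.node 0 hn).solution hG
      (fun j hj => by simp [processed, hj, Nat.pos_iff_ne_zero]) hDL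
    simp only [zero_mul, add_zero] at h3
    exact ⟨h3.1, h3.2, h2⟩
  · right
    refine ⟨h1, fun ⟨y, hy⟩ => ?_⟩
    obtain ⟨c, hc, hcd⟩ := hG.complete y hy
    obtain ⟨q, hq, -⟩ := hI4.complete c ⟨hc, fun i hi =>
      (sum_le_sum_of_subset hDL).trans (hcd i hi)⟩
    omega

/-- The bound is monotone in its three arguments, so each may be replaced by their product. The
result is a polynomial of degree 6 in one variable; the constant 500 absorbs its coefficients. -/
theorem programTime_le {k L S : ℕ} (hk : 0 < k) (hL : 0 < L) (hS : 0 < S) :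
    programTime k L S ≤ 500 * (k * L * S) ^ 6 := by
  set X := k * L * S with hX
  have h1 : k ≤ X := Nat.le_of_dvd (by positivity) ⟨L * S, by rw [hX]; ring⟩
  have h2 : L ≤ X := Nat.le_of_dvd (by positivity) ⟨k * S, by rw [hX]; ring⟩
  have h3 : S ≤ X := Nat.le_of_dvd (by positivity) ⟨k * L, by rw [hX]; ring⟩
  have hX1 : 1 ≤ X := hk.trans_le h1
  have h4 : programTime k L S ≤ programTime X X X := by
    unfold programTime mergeTime sameTypeTime layerTime expandTime
    gcongr
  refine h4.trans ?_
  have p : ∀ m ≤ 6, X ^ m ≤ X ^ 6 := fun m hm => Nat.pow_le_pow_right hX1 hm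
  have p0 := p 0 (by norm_num)
  have p1 := p 1 (by norm_num)
  have p2 := p 2 (by norm_num)
  have p3 := p 3 (by norm_num)
  have p4 := p 4 (by norm_num)
  have p5 := p 5 (by norm_num)
  unfold programTime mergeTime sameTypeTime layerTime expandTime
  ring_nf at *
  linarith

/-- The encoding `ty` enters only the analysis and not the program, so the two time bounds differ
just in the choice of `ty`. -/
theorem solvedWithin (I : ClosestString) {α : Type*} [Fintype α] [DecidableEq α] (ty : ℕ → α)
    (hty : ∀ x y : Fin I.L, ty x = ty y →
      ∀ p q : Fin I.k, (I.str p x = I.str q x ↔ I.str p y = I.str q y)) :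
    I.SolvedWithin program (500 * (I.k * I.L * (2 * I.k * Fintype.card α + 2) ^ I.k) ^ 6) := by
  set a : ℕ → ℕ → ℕ := fun i x => I.input.mem (i * I.L + x) with ha
  have hstr : ∀ (i : Fin I.k) (x : Fin I.L), a i x = I.str i x := by
    intro i x
    have h1 := mul_add_lt i.2 x.2
    have h2 : (i * I.L + x : ℕ) / I.L = i := by
      rw [mul_comm, Nat.mul_add_div I.L_pos, Nat.div_eq_of_lt x.2, add_zero]
    have h3 : (i * I.L + x : ℕ) % I.L = x := by
      rw [mul_comm, Nat.mul_add_mod, Nat.mod_eq_of_lt x.2]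
    simp only [ha, input, dif_pos h1, h2, h3]
  have hham : ∀ (y : Fin I.L → Fin I.σ) (z : ℕ → ℕ), (∀ x : Fin I.L, z x = y x) →
      ∀ i : Fin I.k, hammingDist y (I.str i) = #{x ∈ range I.L | z x ≠ a i x} := by
    intro y z hz i
    rw [hammingDist, card_filter, card_filter, sum_range]
    refine sum_congr rfl fun x _ => ?_
    simp only [hz, hstr, ne_eq, Fin.val_inj]
  obtain ⟨t, s, hr, ht, hs⟩ := wp_program (k := I.k) (L := I.L) (d := I.d) (a := a) (s := I.input)
    (S := (2 * I.k * Fintype.card α + 2) ^ I.k) ty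
    (fun x hx y hy h p hp q hq => by
      have := hty ⟨x, hx⟩ ⟨y, hy⟩ h ⟨p, hp⟩ ⟨q, hq⟩
      rw [← Fin.val_inj, ← Fin.val_inj, ← hstr, ← hstr, ← hstr, ← hstr] at this
      exact this) rfl I.k_pos rfl rfl rfl (fun _ _ _ _ => rfl)
  refine ⟨t, s, hr, ht.trans (programTime_le I.k_pos I.L_pos (by positivity)), ?_⟩
  rcases hs with ⟨h1, y, h2, h3, h4⟩ | ⟨h1, h2⟩
  -- Every output letter is copied from an input string, so it belongs to the alphabet.
  · have hlt : ∀ x : Fin I.L, y x < I.σ := by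
      intro x
      obtain ⟨c, hc, h⟩ := h3 x x.2
      rw [h]
      exact (hstr ⟨c, hc⟩ x).trans_lt (I.str ⟨c, hc⟩ x).2
    refine .inl ⟨h1, fun x => ⟨y x, hlt x⟩, fun i => ?_, fun j => h4 j j.2⟩
    rw [hham _ y (fun _ => rfl) i]
    exact h2 i i.2
  · refine .inr ⟨h1, fun ⟨y, hy⟩ => h2
      ⟨fun x => if h : x < I.L then y ⟨x, h⟩ else 0, fun i hi => ?_⟩⟩
    have := hy ⟨i, hi⟩
    rwa [hham y (fun x => if h : x < I.L then y ⟨x, h⟩ else 0) (fun x => by simp) ⟨i, hi⟩] at this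

/-- A type is encoded by sending each row to a chosen row with the same letter. This gives at most
`k ^ k` codes, independently of the alphabet size. -/
theorem solvedWithin_general (I : ClosestString) :
    I.SolvedWithin program (500 * (I.k * I.L * (2 * I.k * I.k ^ I.k + 2) ^ I.k) ^ 6) := by
  classical
  have : Nonempty (Fin I.k) := ⟨⟨0, I.k_pos⟩⟩
  let col : ℕ → Fin I.k → ℕ := fun x p => if h : x < I.L then I.str p ⟨x, h⟩ else 0
  have key : ∀ x p q, Function.invFun (col x) (col x p) = Function.invFun (col x) (col x q) ↔
      col x p = col x q := by
    refine fun x p q => ⟨fun h => ?_, fun h => by rw [h]⟩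
    rw [← Function.invFun_eq (f := col x) ⟨p, rfl⟩, h, Function.invFun_eq (f := col x) ⟨q, rfl⟩]
  have := solvedWithin I (fun x p => Function.invFun (col x) (col x p)) fun x y h p q => by
    have h1 := key x p q
    have h2 := key y p q
    rw [congrFun h p, congrFun h q, h2] at h1
    simpa [col, Fin.val_inj] using h1.symm
  simpa using this

/-- Here the column itself serves as the code of its type. -/
theorem solvedWithin_binary (I : ClosestString) (h2 : I.IsBinary) :
    I.SolvedWithin program (500 * (I.k * I.L * (2 * I.k * 2 ^ I.k + 2) ^ I.k) ^ 6) := by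
  have hσ : I.σ = 2 := h2
  have hpos : 0 < I.σ := by omega
  have := solvedWithin I (α := Fin I.k → Fin I.σ)
    (fun x p => if h : x < I.L then I.str p ⟨x, h⟩ else ⟨0, hpos⟩) fun x y h p q => by
      have h1 := congrFun h p
      have h2 := congrFun h q
      simp only [Fin.is_lt, dif_pos, Fin.eta] at h1 h2
      rw [h1, h2]
  simpa [hσ] using this

/-! ### Simplifying the time bounds -/

theorem general_bound {k L C : ℕ} (hk : 0 < k) (hL : 0 < L) (hC : 500 * 4 ^ 6 ≤ C) :
    500 * (k * L * (2 * k * k ^ k + 2) ^ k) ^ 6 ≤ C * k ^ (C * k ^ 2) * L ^ C := by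
  rcases Nat.lt_or_ge k 2 with h | h
  -- For `k = 1` the factor `k ^ (C * k ^ 2)` is 1, so the constant alone must absorb `500 * 4 ^ 6`.
  · obtain rfl : k = 1 := by omega
    have h1 : L ^ 6 ≤ L ^ C := Nat.pow_le_pow_right hL (by omega)
    calc 500 * (1 * L * (2 * 1 * 1 ^ 1 + 2) ^ 1) ^ 6 = 500 * 4 ^ 6 * L ^ 6 := by ring
      _ ≤ C * 1 ^ (C * 1 ^ 2) * L ^ C := by
        rw [one_pow, mul_one]
        exact Nat.mul_le_mul hC h1
  -- Since `k ≥ 2`, the factor `k ^ 3` is at least 8 and absorbs the constants.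
  · have h1 : 2 * k * k ^ k + 2 ≤ k ^ (k + 4) := by
      have e1 : k ^ (k + 4) = k ^ 3 * (k * k ^ k) := by ring
      have e2 : 2 ^ 3 ≤ k ^ 3 := Nat.pow_le_pow_left h 3
      have e3 : 1 ≤ k * k ^ k := Nat.mul_pos hk (by positivity)
      have e4 : 2 ^ 3 * (k * k ^ k) ≤ k ^ 3 * (k * k ^ k) := Nat.mul_le_mul_right _ e2
      rw [e1]
      linarith
    calc 500 * (k * L * (2 * k * k ^ k + 2) ^ k) ^ 6
        ≤ 500 * (k * L * (k ^ (k + 4)) ^ k) ^ 6 := by gcongr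
      _ = 500 * k ^ (6 * (1 + (k + 4) * k)) * L ^ 6 := by
          rw [← pow_mul, mul_right_comm, ← pow_succ', mul_pow, ← pow_mul]; ring
      _ ≤ C * k ^ (C * k ^ 2) * L ^ C := by
          have h2 : 6 * (1 + (k + 4) * k) ≤ C * k ^ 2 :=
            le_trans (by nlinarith) (Nat.mul_le_mul_right _ hC)
          exact Nat.mul_le_mul (Nat.mul_le_mul (by omega) (Nat.pow_le_pow_right hk h2))
            (Nat.pow_le_pow_right hL (by omega))

theorem binary_bound {k L C : ℕ} (hk : 0 < k) (hL : 0 < L) (hC : 500 ≤ C) :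
    500 * (k * L * (2 * k * 2 ^ k + 2) ^ k) ^ 6 ≤ C * 2 ^ (C * k ^ 2) * L ^ C := by
  have h0 : k ≤ 2 ^ k := Nat.lt_two_pow_self.le
  -- The polynomial factor `k` is absorbed by `k ≤ 2 ^ k`, so the exponent stays linear in `k` and
  -- becomes quadratic after the power `k`.
  have h1 : 2 * k * 2 ^ k + 2 ≤ 2 ^ (2 * k + 2) := by
    have e1 : 2 ^ (2 * k + 2) = 4 * (2 ^ k * 2 ^ k) := by ring
    have e2 : k * 2 ^ k ≤ 2 ^ k * 2 ^ k := Nat.mul_le_mul_right _ h0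
    have e3 : 1 ≤ 2 ^ k * 2 ^ k := Nat.mul_pos (by positivity) (by positivity)
    rw [e1]
    linarith
  calc 500 * (k * L * (2 * k * 2 ^ k + 2) ^ k) ^ 6
      ≤ 500 * (2 ^ k * L * (2 ^ (2 * k + 2)) ^ k) ^ 6 := by gcongr
    _ = 500 * 2 ^ (6 * (k + (2 * k + 2) * k)) * L ^ 6 := by
        rw [← pow_mul, mul_right_comm, ← pow_add, mul_pow, ← pow_mul]; ring
    _ ≤ C * 2 ^ (C * k ^ 2) * L ^ C := by
        have h2 : 6 * (k + (2 * k + 2) * k) ≤ C * k ^ 2 :=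
          le_trans (by nlinarith) (Nat.mul_le_mul_right _ hC)
        exact Nat.mul_le_mul (Nat.mul_le_mul hC (Nat.pow_le_pow_right (by norm_num) h2))
          (Nat.pow_le_pow_right hL (by omega))

end ClosestString

theorem mainTheorem7 :
    (∃ (P : RAM.Program) (C : ℕ), ∀ I : ClosestString,
      I.SolvedWithin P (C * I.k ^ (C * I.k ^ 2) * I.L ^ C)) ∧
    (∃ (P : RAM.Program) (C : ℕ), ∀ I : ClosestString, I.IsBinary →
      I.SolvedWithin P (C * 2 ^ (C * I.k ^ 2) * I.L ^ C)) := by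
  refine ⟨⟨ClosestString.program, 500 * 4 ^ 6, fun I => ?_⟩,
    ⟨ClosestString.program, 500, fun I hI => ?_⟩⟩
  · obtain ⟨t, s, hr, ht, hs⟩ := I.solvedWithin_general
    exact ⟨t, s, hr, ht.trans (ClosestString.general_bound I.k_pos I.L_pos le_rfl), hs⟩
  · obtain ⟨t, s, hr, ht, hs⟩ := I.solvedWithin_binary hI
    exact ⟨t, s, hr, ht.trans (ClosestString.binary_bound I.k_pos I.L_pos le_rfl), hs⟩
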